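/- Fix $\varepsilon>0$ and values $v=n\varepsilon>w=m\varepsilon$ with integers $n>m\ge 0$. Two bidders, the high player with value $v$ and the low player with value $w$, repeatedly play a single-item second-price auction with ties broken uniformly at random. The bids of a player are the multiples of $\varepsilon$ from $0$ up to his value. A player with value $x$ who bids $b$ against $b'$ has (expected) utility $u(b,b')=x-b'$ if $b>b'$, $(x-b')/2$ if $b=b'$, and $0$ if $b<b'$. Each bidder $i\in\{1,2\}$ ($1$ is the high player) is represented by a multiplicative-weights agent with full feedback: every bid has initial weight $1$; in every round the agent draws a bid with probability proportional to the current weights, independently of the other agent given the past, and then multiplies the weight of every bid $b$ by $1+\eta\,u(b,b')$ (linear version) or by $e^{\eta u(b,b')}$ (Hedge), where $b'$ is the opponent's realized bid; either version may be used by either agent. The update parameter $\eta=\eta_i(T)>0$ depends on the horizon $T$ but not on the round $1\le t\le T$, with $\eta_1(T)\to 0$, $T\eta_1(T)\to\infty$, and $\eta_2(T)/\eta_1(T)\to\rho$ for some $\rho\in(0,\infty)$ as $T\to\infty$ (e.g. the agents use a common update parameter and $\rho=1$). Say that a statistic $X^T_t$ of the first $t$ rounds of the dynamics with horizon $T$ converges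 to $x$ if for every $\delta>0$ there is $T_0$ such that for every $T>T_0$, with probability at least $1-\delta$, $|X^T_t-x|<\delta$ for all $\delta T<t\le T$. Then there is a probability distribution $p$ on pairs of bids (high player, low player) such that the empirical distribution of the pair of bids converges to $p$, and: 1. under $p$, the high player's bid has $\Pr[0]=\Pr[\varepsilon]=\dots=\Pr[w]=0$ and $\Pr[w+\varepsilon]=\dots=\Pr[v]=\frac{\varepsilon}{v-w}$; 2. under $p$, the low player's bid has $0<\Pr[0]\le\Pr[\varepsilon]\le\dots\le\Pr[w]$; 3. in the limit the high player always wins: every pair of bids with positive probability under $p$ has the high player's bid strictly above the low player's, and the fraction of auctions won by the high player converges to $1$; 4. the average price that the high player pays in the auctions he wins converges to the mean of the low player's bid under $p$, and, if $w>0$, this limit is strictly less than the second price $w$. -/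

import Mathlib

open Filter Topology

namespace MWAuction

noncomputable section

/-- Expected utility, in a single-item second-price auction with uniform tie-breaking, of a bidder
with value `value` who bids `own` against the bid `other`. -/
def utility (value own other : ℝ) : ℝ :=
  if other < own then value - other
  else if own = other then (value - other) / 2
  else 0

/-- The two standard variants of the multiplicative-weights update. -/
inductive UpdateRule where
  | linear
  | hedge

/-- The factor by which the weight of a bid that would have given utility `u` is multiplied:
`1 + η u` (linear multiplicative weights) or `exp (η u)` (Hedge). -/
def UpdateRule.factor (rule : UpdateRule) (η u : ℝ) : ℝ :=
  match rule with
  | .linear => 1 + η * u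
  | .hedge => Real.exp (η * u)

/-- The bids of a bidder with value `N * ε` are `0, ε, …, N * ε`; the index `k` stands for the bid
`k * ε`. -/
def bid (ε : ℝ) {N : ℕ} (k : Fin (N + 1)) : ℝ := (k : ℕ) * ε

/-- The record of one auction: the bid of the high player (value `n * ε`), the bid of the low player
(value `m * ε`), and a fair coin that decides the winner in case of a tie. -/
abbrev Round (n m : ℕ) : Type := (Fin (n + 1) × Fin (m + 1)) × Bool

/-- The records of the first `T` auctions. -/
abbrev History (n m T : ℕ) : Type := Fin T → Round n m

/-- Just before round `t`, the weight that an agent with value `N * ε` gives to its bid `k`, when its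
opponent's bids are `opp`. All weights are initially `1`, and after every round the weight of every
bid is multiplied by the factor of the utility this bid would have had in that round. -/
def weight (rule : UpdateRule) (η ε : ℝ) {N M T : ℕ} (opp : Fin T → Fin (M + 1)) (t : Fin T)
    (k : Fin (N + 1)) : ℝ :=
  ∏ s ∈ Finset.Iio t, rule.factor η (utility (N * ε) (bid ε k) (bid ε (opp s)))

/-- The probability with which the agent plays the bid `k` in round `t`. -/
def mixed (rule : UpdateRule) (η ε : ℝ) {N M T : ℕ} (opp : Fin T → Fin (M + 1)) (t : Fin T)
    (k : Fin (N + 1)) : ℝ :=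
  weight rule η ε opp t k / ∑ k' : Fin (N + 1), weight rule η ε opp t k'

/-- The law of the first `T` auctions: in every round, given the past, the two bids and the
tie-breaking coin are drawn independently, the bids from the agents' current distributions. -/
def law (rule₁ rule₂ : UpdateRule) (η₁ η₂ ε : ℝ) {n m T : ℕ} (ω : History n m T) : ℝ :=
  ∏ t : Fin T,
    mixed rule₁ η₁ ε (fun s => (ω s).1.2) t (ω t).1.1 *
      mixed rule₂ η₂ ε (fun s => (ω s).1.1) t (ω t).1.2 * (1 / 2)

open Classical in
/-- The probability of the event `A` when the outcome `ω` has probability `P ω`. -/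
def prob {Ω : Type} [Fintype Ω] (P : Ω → ℝ) (A : Set Ω) : ℝ :=
  ∑ ω, if ω ∈ A then P ω else 0

/-- The empirical distribution of the pair of bids after the first `t` rounds. -/
def empirical {n m T : ℕ} (ω : History n m T) (t : ℕ) (b : Fin (n + 1) × Fin (m + 1)) : ℝ :=
  ((Finset.univ.filter fun s : Fin T => (s : ℕ) < t ∧ (ω s).1 = b).card : ℝ) / t

/-- The high player wins: he bids more, or the bids are equal and the coin favours him. -/
def HighWins {n m : ℕ} (r : Round n m) : Prop :=
  (r.1.2 : ℕ) < r.1.1 ∨ ((r.1.2 : ℕ) = r.1.1 ∧ r.2 = true)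

open Classical in
/-- The rounds, among the first `t`, that the high player wins. -/
def wonRounds {n m T : ℕ} (ω : History n m T) (t : ℕ) : Finset (Fin T) :=
  Finset.univ.filter fun s : Fin T => (s : ℕ) < t ∧ HighWins (ω s)

/-- The fraction of the first `t` auctions that the high player wins. -/
def winFrequency {n m T : ℕ} (ω : History n m T) (t : ℕ) : ℝ :=
  ((wonRounds ω t).card : ℝ) / t

/-- The average price (the low player's bid) that the high player pays in the auctions that he wins
among the first `t`. -/
def averagePrice (ε : ℝ) {n m T : ℕ} (ω : History n m T) (t : ℕ) : ℝ :=
  (∑ s ∈ wonRounds ω t, bid ε (ω s).1.2) / (wonRounds ω t).card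

/-- Convergence of a statistic `X` of the dynamics to `x`. The horizon-`T` dynamics has law `P T`, and
`X T ω t` is the value of the statistic after `t` of the `T` rounds: for every `δ > 0` and all large
horizons `T`, with probability at least `1 - δ` the statistic is `δ`-close to `x` at all times
`δ T < t ≤ T`. -/
def Converges {n m : ℕ} {E : Type} [PseudoMetricSpace E] (P : ∀ T : ℕ, History n m T → ℝ)
    (X : ∀ T : ℕ, History n m T → ℕ → E) (x : E) : Prop :=
  ∀ δ : ℝ, 0 < δ → ∃ T₀ : ℕ, ∀ T : ℕ, T₀ < T →
    1 - δ ≤ prob (P T) {ω | ∀ t : ℕ, δ * T < t → t ≤ T → dist (X T ω t) x < δ}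

/-- The probability that the high player bids `k`, under a joint distribution of bids. -/
def highMarginal {n m : ℕ} (p : Fin (n + 1) × Fin (m + 1) → ℝ) (k : Fin (n + 1)) : ℝ :=
  ∑ j, p (k, j)

/-- The probability that the low player bids `j`, under a joint distribution of bids. -/
def lowMarginal {n m : ℕ} (p : Fin (n + 1) × Fin (m + 1) → ℝ) (j : Fin (m + 1)) : ℝ :=
  ∑ k, p (k, j)

end

end MWAuction

open MWAuction

namespace MWAuction

/-! In logarithms, both update rules are additive: a bid with utility `u` gains `η u + O(η²)`, and
an agent plays the softmax of its log-weights. Three facts about the auction drive the proof.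
Utility is nondecreasing in one's own bid up to one's value, so the low player's log-weights are
always ordered and his bid `w` keeps probability at least `1/(m+1)`. Against `w`, every bid `k ≤ m`
of the high player earns at most half of what `v` earns, so its weight relative to `v` contracts in
conditional mean by `1 - rate * η₁` per round (`mean_ratio_le`). Bids above `w` all earn the same,
so they always have equal probability; and against them every low bid earns zero.

Hence the high player becomes uniform on `(w, v]`, exponentially fast in the time `η₁ t`, and the
expected growth of the low player's log-weights after time `S` is `O(exp (-rate * S))`
(`mean_lowWeight_sub_le`). These log-weights therefore freeze at finite values, which is why every
low bid keeps positive probability and the average price stays below `w`.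

The frozen values could still be random. They are not: up to a fixed time `S` there are about `S /
η₁` steps of size `O(η₁)`, so the log-weights follow a Lipschitz differential equation up to a
mean-square error that vanishes with `η₁` (`IsKernel.mean_sq_sub_solution_le`). The values of the
solution at times `N` are Cauchy by the tail bound, and their limit `lowLimit` is deterministic
(`exists_eventually_close`).

Since `T η₁ → ∞`, the initial phase of `S / η₁` rounds is a vanishing fraction of `T`. Afterwards
the conditional law of a round is close in mean to the product of the uniform law and the softmax of
`lowLimit`. Kolmogorov's inequality for the counts minus their conditional probabilities, and
Markov's inequality for the remaining error, give convergence at all times `t > δ T` at once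
(`converges_empirical`). Win frequency and average price are controlled by the empirical
distribution. -/

/-- The expectation of `f` when the outcome `ω` has probability `P ω`. -/
noncomputable def mean {Ω : Type} [Fintype Ω] (P f : Ω → ℝ) : ℝ := ∑ ω, P ω * f ω

/-! ### Expectation and probability on a finite space -/

section Mean

variable {Ω : Type} [Fintype Ω] {P f g : Ω → ℝ}

lemma mean_mono (hP : ∀ ω, 0 ≤ P ω) (h : ∀ ω, f ω ≤ g ω) : mean P f ≤ mean P g :=
  Finset.sum_le_sum fun ω _ => mul_le_mul_of_nonneg_left (h ω) (hP ω)

lemma mean_nonneg (hP : ∀ ω, 0 ≤ P ω) (h : ∀ ω, 0 ≤ f ω) : 0 ≤ mean P f :=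
  Finset.sum_nonneg fun ω _ => mul_nonneg (hP ω) (h ω)

lemma mean_add (P f g : Ω → ℝ) : mean P (fun ω => f ω + g ω) = mean P f + mean P g := by
  simp [mean, mul_add, Finset.sum_add_distrib]

lemma mean_sub (P f g : Ω → ℝ) : mean P (fun ω => f ω - g ω) = mean P f - mean P g := by
  simp [mean, mul_sub, Finset.sum_sub_distrib]

lemma mean_const_mul (P f : Ω → ℝ) (c : ℝ) : mean P (fun ω => c * f ω) = c * mean P f := by
  simp only [mean, Finset.mul_sum]
  exact Finset.sum_congr rfl fun _ _ => by ring

lemma mean_sum {ι : Type*} (s : Finset ι) (P : Ω → ℝ) (f : ι → Ω → ℝ) :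
    mean P (fun ω => ∑ i ∈ s, f i ω) = ∑ i ∈ s, mean P (f i) := by
  simp only [mean, Finset.mul_sum]
  exact Finset.sum_comm

lemma mean_const (hP : ∑ ω, P ω = 1) (c : ℝ) : mean P (fun _ => c) = c := by
  simp [mean, ← Finset.sum_mul, hP]

lemma mean_sq_le (hP : ∀ ω, 0 ≤ P ω) (h1 : ∑ ω, P ω = 1) (f : Ω → ℝ) :
    mean P f ^ 2 ≤ mean P (fun ω => f ω ^ 2) := by
  have e : ∀ c : ℝ, mean P (fun ω => (f ω - c) ^ 2)
      = mean P (fun ω => f ω ^ 2) - 2 * c * mean P f + c ^ 2 := fun c => by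
    have h2 := mean_const h1 (c ^ 2)
    rw [← mean_const_mul, ← mean_sub, ← h2, ← mean_add]
    congr 1
    ext ω
    ring
  have h : 0 ≤ mean P (fun ω => (f ω - mean P f) ^ 2) := mean_nonneg hP fun ω => sq_nonneg _
  rw [e] at h
  nlinarith

open Classical in
lemma prob_eq_mean (P : Ω → ℝ) (A : Set Ω) : prob P A = mean P (fun ω => if ω ∈ A then 1 else 0) := by
  simp [prob, mean]

lemma prob_mono (hP : ∀ ω, 0 ≤ P ω) {A B : Set Ω} (h : A ⊆ B) : prob P A ≤ prob P B := by
  classical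
  rw [prob_eq_mean, prob_eq_mean]
  refine mean_mono hP fun ω => ?_
  by_cases hA : ω ∈ A
  · simp [hA, h hA]
  · simp only [hA, if_false]
    split_ifs <;> simp

lemma prob_compl (h1 : ∑ ω, P ω = 1) (A : Set Ω) : prob P Aᶜ = 1 - prob P A := by
  classical
  rw [prob_eq_mean, prob_eq_mean]
  nth_rw 2 [← mean_const h1 1]
  rw [← mean_sub]
  congr 1
  ext ω
  by_cases hA : ω ∈ A <;> simp [hA]

lemma prob_union_le (hP : ∀ ω, 0 ≤ P ω) (A B : Set Ω) :
    prob P (A ∪ B) ≤ prob P A + prob P B := by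
  classical
  rw [prob_eq_mean, prob_eq_mean, prob_eq_mean, ← mean_add]
  refine mean_mono hP fun ω => ?_
  by_cases hA : ω ∈ A <;> by_cases hB : ω ∈ B <;> simp [hA, hB]

lemma prob_iUnion_le {ι : Type*} [Fintype ι] (hP : ∀ ω, 0 ≤ P ω) (A : ι → Set Ω) :
    prob P (⋃ i, A i) ≤ ∑ i, prob P (A i) := by
  classical
  simp only [prob_eq_mean]
  rw [← mean_sum]
  refine mean_mono hP fun ω => ?_
  by_cases h : ω ∈ ⋃ i, A i
  · obtain ⟨i, hi⟩ := Set.mem_iUnion.1 h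
    rw [if_pos h]
    calc (1 : ℝ) = if ω ∈ A i then 1 else 0 := by rw [if_pos hi]
      _ ≤ _ := Finset.single_le_sum (f := fun i => if ω ∈ A i then (1 : ℝ) else 0)
        (fun i _ => by split_ifs <;> norm_num) (Finset.mem_univ i)
  · rw [if_neg h]
    exact Finset.sum_nonneg fun i _ => by split_ifs <;> norm_num

/-- Markov's inequality. -/
lemma mul_prob_le_mean (hP : ∀ ω, 0 ≤ P ω) (hf : ∀ ω, 0 ≤ f ω) (c : ℝ) :
    c * prob P {ω | c ≤ f ω} ≤ mean P f := by
  classical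
  rw [prob_eq_mean, ← mean_const_mul]
  refine mean_mono hP fun ω => ?_
  by_cases h : c ≤ f ω
  · simp [h]
  · simp [h, hf ω]

end Mean

/-! ### Finite processes given by conditional probabilities -/

section Kernel

variable {R : Type} {T : ℕ}

/-- `g ω` only depends on the first `t` coordinates of `ω`. -/
def Predictable {α : Type*} (t : ℕ) (g : (Fin T → R) → α) : Prop :=
  ∀ ω ω' : Fin T → R, (∀ s : Fin T, (s : ℕ) < t → ω s = ω' s) → g ω = g ω'

lemma Predictable.mono {α : Type*} {s t : ℕ} {g : (Fin T → R) → α} (h : Predictable s g)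
    (hst : s ≤ t) : Predictable t g :=
  fun ω ω' e => h ω ω' fun i hi => e i (hi.trans_le hst)

lemma snoc_agree (ω : Fin T → R) (r r' : R) (t : ℕ) (ht : t ≤ T) (s : Fin (T + 1))
    (hs : (s : ℕ) < t) :
    (Fin.snoc ω r : Fin (T + 1) → R) s = (Fin.snoc ω r' : Fin (T + 1) → R) s := by
  have : s = Fin.castSucc ⟨s, by omega⟩ := rfl
  rw [this, Fin.snoc_castSucc (α := fun _ => R), Fin.snoc_castSucc (α := fun _ => R)]

variable [Fintype R]

/-- `q t ω r` is the conditional probability of `r` at time `t` given the past of `ω`. -/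
structure IsKernel (q : Fin T → (Fin T → R) → R → ℝ) : Prop where
  nonneg : ∀ t ω r, 0 ≤ q t ω r
  sum_eq_one : ∀ t ω, ∑ r, q t ω r = 1
  predictable : ∀ t : Fin T, Predictable (t : ℕ) (q t)

/-- The law of the process with conditional probabilities `q`. -/
def seqLaw (q : Fin T → (Fin T → R) → R → ℝ) (ω : Fin T → R) : ℝ := ∏ t, q t ω (ω t)

lemma IsKernel.seqLaw_nonneg {q : Fin T → (Fin T → R) → R → ℝ} (hq : IsKernel q) (ω : Fin T → R) :
    0 ≤ seqLaw q ω :=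
  Finset.prod_nonneg fun t _ => hq.nonneg t ω _

lemma sum_snoc (f : (Fin (T + 1) → R) → ℝ) :
    ∑ ω, f ω = ∑ ω : Fin T → R, ∑ r, f (Fin.snoc ω r) := by
  rw [← (Fin.snocEquiv fun _ : Fin (T + 1) => R).sum_comp, Fintype.sum_prod_type, Finset.sum_comm]
  rfl

/-- The kernel of the first `T` steps. -/
def initKernel (r₀ : R) (q : Fin (T + 1) → (Fin (T + 1) → R) → R → ℝ) :
    Fin T → (Fin T → R) → R → ℝ :=
  fun t ω => q t.castSucc (Fin.snoc ω r₀)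

lemma IsKernel.init {q : Fin (T + 1) → (Fin (T + 1) → R) → R → ℝ} (hq : IsKernel q) (r₀ : R) :
    IsKernel (initKernel r₀ q) where
  nonneg t ω r := hq.nonneg _ _ _
  sum_eq_one t ω := hq.sum_eq_one _ _
  predictable t ω ω' h := hq.predictable _ _ _ fun s hs => by
    have e : s = Fin.castSucc ⟨s, by have := t.2; simp at hs; omega⟩ := rfl
    rw [e, Fin.snoc_castSucc (α := fun _ => R), Fin.snoc_castSucc (α := fun _ => R)]
    exact h _ hs

lemma IsKernel.seqLaw_snoc {q : Fin (T + 1) → (Fin (T + 1) → R) → R → ℝ} (hq : IsKernel q)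
    (r₀ : R) (ω : Fin T → R) (r : R) :
    seqLaw q (Fin.snoc ω r)
      = seqLaw (initKernel r₀ q) ω * q (Fin.last T) (Fin.snoc ω r₀) r := by
  rw [seqLaw, Fin.prod_univ_castSucc, seqLaw]
  congr 1
  · refine Finset.prod_congr rfl fun t _ => ?_
    rw [Fin.snoc_castSucc (α := fun _ => R), initKernel,
      hq.predictable t.castSucc _ _ (fun s hs => snoc_agree ω r r₀ _ t.2.le s hs)]
  · rw [Fin.snoc_last, hq.predictable (Fin.last T) _ _
      (fun s hs => snoc_agree ω r r₀ _ (by simp) s hs)]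

lemma IsKernel.mean_snoc {q : Fin (T + 1) → (Fin (T + 1) → R) → R → ℝ} (hq : IsKernel q)
    (r₀ : R) (f : (Fin (T + 1) → R) → ℝ) :
    mean (seqLaw q) f = mean (seqLaw (initKernel r₀ q))
      (fun ω => ∑ r, q (Fin.last T) (Fin.snoc ω r₀) r * f (Fin.snoc ω r)) := by
  simp only [mean]
  rw [sum_snoc]
  refine Finset.sum_congr rfl fun ω _ => ?_
  rw [Finset.mul_sum]
  refine Finset.sum_congr rfl fun r _ => ?_
  rw [hq.seqLaw_snoc r₀, mul_assoc]

lemma IsKernel.sum_seqLaw [Nonempty R] {q : Fin T → (Fin T → R) → R → ℝ} (hq : IsKernel q) :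
    ∑ ω, seqLaw q ω = 1 := by
  obtain ⟨r₀⟩ := ‹Nonempty R›
  induction T with
  | zero => simp [seqLaw]
  | succ T ih =>
    have := hq.mean_snoc r₀ (fun _ => 1)
    simp only [mul_one, hq.sum_eq_one] at this
    simpa [mean, ih (hq.init r₀)] using this

/-- The law of total expectation. -/
lemma IsKernel.mean_eq [Nonempty R] {q : Fin T → (Fin T → R) → R → ℝ} (hq : IsKernel q)
    (t : Fin T) (g : (Fin T → R) → R → ℝ) (hg : Predictable (t : ℕ) g) :
    mean (seqLaw q) (fun ω => g ω (ω t)) = mean (seqLaw q) (fun ω => ∑ r, q t ω r * g ω r) := by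
  obtain ⟨r₀⟩ := ‹Nonempty R›
  induction T with
  | zero => exact t.elim0
  | succ T ih =>
    rw [hq.mean_snoc r₀, hq.mean_snoc r₀]
    induction t using Fin.lastCases with
    | last =>
      congr 1
      ext ω
      have key : ∀ r, g (Fin.snoc ω r) = g (Fin.snoc ω r₀) := fun r =>
        hg _ _ fun s hs => snoc_agree ω r r₀ _ (by simp) s hs
      have key' : ∀ r, q (Fin.last T) (Fin.snoc ω r) = q (Fin.last T) (Fin.snoc ω r₀) := fun r =>
        hq.predictable _ _ _ fun s hs => snoc_agree ω r r₀ _ (by simp) s hs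
      simp only [Fin.snoc_last, key, key']
      rw [← Finset.sum_mul, hq.sum_eq_one, one_mul]
    | cast t =>
      -- At an earlier time nothing depends on the last coordinate, so it sums out to one and can be
      -- replaced by the dummy `r₀`.
      have ht : ((t.castSucc : Fin (T + 1)) : ℕ) ≤ T := t.2.le
      have key : ∀ ω : Fin T → R, ∀ r, g (Fin.snoc ω r) = g (Fin.snoc ω r₀) := fun ω r =>
        hg _ _ fun s hs => snoc_agree ω r r₀ _ ht s hs
      have key' : ∀ ω : Fin T → R, ∀ r, q t.castSucc (Fin.snoc ω r)
          = q t.castSucc (Fin.snoc ω r₀) := fun ω r =>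
        hq.predictable _ _ _ fun s hs => snoc_agree ω r r₀ _ ht s hs
      simp only [Fin.snoc_castSucc (α := fun _ => R), key, key', ← Finset.sum_mul, hq.sum_eq_one,
        one_mul]
      refine ih (hq.init r₀) t (fun ω => g (Fin.snoc ω r₀)) fun ω ω' h => hg _ _ fun s hs => ?_
      have e : s = Fin.castSucc ⟨s, by have := t.2; simp at hs; omega⟩ := rfl
      rw [e, Fin.snoc_castSucc (α := fun _ => R), Fin.snoc_castSucc (α := fun _ => R)]
      exact h _ hs

/-- A bound on the conditional expectations of one step bounds the expectation. -/
lemma IsKernel.mean_le [Nonempty R] {q : Fin T → (Fin T → R) → R → ℝ} (hq : IsKernel q)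
    (t : Fin T) (g : (Fin T → R) → R → ℝ) (hg : Predictable (t : ℕ) g) {f h : (Fin T → R) → ℝ}
    (hf : ∀ ω, f ω ≤ g ω (ω t)) (hh : ∀ ω, ∑ r, q t ω r * g ω r ≤ h ω) :
    mean (seqLaw q) f ≤ mean (seqLaw q) h :=
  (mean_mono hq.seqLaw_nonneg hf).trans
    ((hq.mean_eq t g hg).le.trans (mean_mono hq.seqLaw_nonneg hh))

/-- **Kolmogorov's maximal inequality** for a martingale with increments `d`. -/
lemma IsKernel.maximal_inequality [Nonempty R] {q : Fin T → (Fin T → R) → R → ℝ}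
    (hq : IsKernel q) (M : ℕ → (Fin T → R) → ℝ) (d : Fin T → (Fin T → R) → R → ℝ)
    (hM0 : ∀ ω, M 0 ω = 0) (hM : ∀ (t : Fin T) ω, M (t + 1) ω = M t ω + d t ω (ω t))
    (hMp : ∀ t, Predictable t (M t)) (hdp : ∀ t : Fin T, Predictable (t : ℕ) (d t))
    (hd : ∀ t ω, ∑ r, q t ω r * d t ω r = 0) {C : ℝ} (hC : 0 ≤ C)
    (hd2 : ∀ t ω, ∑ r, q t ω r * d t ω r ^ 2 ≤ C) {b : ℝ} (hb : 0 < b) :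
    b ^ 2 * prob (seqLaw q) {ω | ∃ s ≤ T, b ≤ |M s ω|} ≤ C * T := by
  classical
  -- The square of the martingale, frozen at the value `b ^ 2` from the first crossing of the level
  -- `b` on. Its mean grows by at most `C` per step, and it equals `b ^ 2` on the event in question.
  let Φ : ℕ → (Fin T → R) → ℝ := fun t ω => if ∃ s ≤ t, b ≤ |M s ω| then b ^ 2 else M t ω ^ 2
  have hΦ : ∀ t, t ≤ T → mean (seqLaw q) (Φ t) ≤ C * t := by
    intro t
    induction t with
    | zero =>
      intro _
      have : Φ 0 = fun _ => 0 := by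
        ext ω
        simp [Φ, hM0, hb]
      simp [this, mean]
    | succ t ih =>
      intro ht
      have h := ih (by omega)
      let i : Fin T := ⟨t, by omega⟩
      have step : mean (seqLaw q) (Φ (t + 1)) ≤ mean (seqLaw q) (fun ω => Φ t ω + C) := by
        refine hq.mean_le i
          (fun ω r => if ∃ s ≤ t, b ≤ |M s ω| then b ^ 2 else (M t ω + d i ω r) ^ 2) ?_ ?_ ?_
        · intro ω ω' h
          have h1 : ∀ s ≤ t, M s ω = M s ω' := fun s hs => (hMp s).mono hs _ _ h
          have h2 : (∃ s ≤ t, b ≤ |M s ω|) ↔ ∃ s ≤ t, b ≤ |M s ω'| := by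
            refine exists_congr fun s => and_congr_right fun hs => by rw [h1 s hs]
          ext r
          simp only [h2, h1 t le_rfl, hdp i _ _ h]
        · intro ω
          have e : M (t + 1) ω = M t ω + d i ω (ω i) := hM i ω
          simp only [Φ]
          by_cases h1 : ∃ s ≤ t, b ≤ |M s ω|
          · rw [if_pos h1]
            obtain ⟨s, hs, hs'⟩ := h1
            rw [if_pos ⟨s, by omega, hs'⟩]
          · rw [if_neg h1, ← e]
            by_cases h2 : ∃ s ≤ t + 1, b ≤ |M s ω|
            · rw [if_pos h2]
              obtain ⟨s, hs, hs'⟩ := h2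
              -- If the first crossing happens at `t + 1`, freezing at `b ^ 2` only lowers the
              -- value, since `b ≤ |M (t + 1) ω|` there.
              rcases Nat.lt_or_ge t s with h3 | h3
              · obtain rfl : s = t + 1 := by omega
                rw [← sq_abs (M _ _)]
                gcongr
              · exact absurd ⟨s, h3, hs'⟩ h1
            · rw [if_neg h2]
        · intro ω
          simp only [Φ]
          by_cases h1 : ∃ s ≤ t, b ≤ |M s ω|
          · simp only [if_pos h1, ← Finset.sum_mul, hq.sum_eq_one]
            linarith
          · simp only [if_neg h1]
            have : ∑ r, q i ω r * (M t ω + d i ω r) ^ 2 = (∑ r, q i ω r) * M t ω ^ 2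
                + 2 * M t ω * (∑ r, q i ω r * d i ω r) + ∑ r, q i ω r * d i ω r ^ 2 := by
              rw [Finset.sum_mul, Finset.mul_sum, ← Finset.sum_add_distrib,
                ← Finset.sum_add_distrib]
              exact Finset.sum_congr rfl fun r _ => by ring
            rw [this, hq.sum_eq_one, hd]
            linarith [hd2 i ω]
      rw [mean_add, mean_const hq.sum_seqLaw] at step
      push_cast
      linarith
  refine le_trans ?_ (hΦ T le_rfl)
  rw [prob_eq_mean, ← mean_const_mul]
  refine mean_mono hq.seqLaw_nonneg fun ω => ?_
  simp only [Φ, Set.mem_ofPred_eq]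
  split_ifs
  · simp
  · simp only [mul_zero]
    positivity

end Kernel

/-! ### Softmax: bounds and Lipschitz continuity -/

section Softmax

variable {ι : Type*} [Fintype ι]

/-- The probability distribution with weights proportional to `exp (x k)`. -/
noncomputable def softmax (x : ι → ℝ) (k : ι) : ℝ := Real.exp (x k) / ∑ k', Real.exp (x k')

lemma sum_exp_pos [Nonempty ι] (x : ι → ℝ) : 0 < ∑ k, Real.exp (x k) :=
  Finset.sum_pos (fun _ _ => Real.exp_pos _) Finset.univ_nonempty

lemma softmax_pos (x : ι → ℝ) (k : ι) : 0 < softmax x k :=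
  have : Nonempty ι := ⟨k⟩
  div_pos (Real.exp_pos _) (sum_exp_pos x)

lemma sum_softmax [Nonempty ι] (x : ι → ℝ) : ∑ k, softmax x k = 1 := by
  simp only [softmax]
  rw [← Finset.sum_div, div_self (sum_exp_pos x).ne']

lemma softmax_le_one (x : ι → ℝ) (k : ι) : softmax x k ≤ 1 := by
  have : Nonempty ι := ⟨k⟩
  rw [← sum_softmax x]
  exact Finset.single_le_sum (f := softmax x) (fun i _ => (softmax_pos x i).le) (Finset.mem_univ k)

lemma softmax_le_softmax (x : ι → ℝ) {k l : ι} (h : x k ≤ x l) : softmax x k ≤ softmax x l := by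
  have : Nonempty ι := ⟨k⟩
  unfold softmax
  have := sum_exp_pos x
  gcongr

lemma softmax_le_exp_sub (x : ι → ℝ) (k l : ι) : softmax x k ≤ Real.exp (x k - x l) := by
  rw [Real.exp_sub, softmax]
  gcongr
  exact Finset.single_le_sum (f := fun i => Real.exp (x i)) (fun i _ => (Real.exp_pos _).le)
    (Finset.mem_univ l)

/-- The largest of finitely many probabilities is at least their average. This is the source of the
lower bound on the probability of the low player's top bid. -/
lemma inv_card_le_softmax (x : ι → ℝ) (k : ι) (h : ∀ l, x l ≤ x k) :
    1 / (Fintype.card ι : ℝ) ≤ softmax x k := by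
  have : Nonempty ι := ⟨k⟩
  have h1 : ∑ l, softmax x l ≤ ∑ _l : ι, softmax x k :=
    Finset.sum_le_sum fun l _ => softmax_le_softmax x (h l)
  rw [sum_softmax, Finset.sum_const, Finset.card_univ, nsmul_eq_mul] at h1
  rw [div_le_iff₀ (by exact_mod_cast Fintype.card_pos)]
  linarith

/-- A perturbation by `d` changes numerator and denominator each by a factor of at most `exp d`, so
probabilities change by a factor of at most `exp (2 * d)`; then `exp (-(2 * d)) ≥ 1 - 2 * d`. -/
lemma softmax_sub_le (x y : ι → ℝ) (k : ι) {d : ℝ} (h : ∀ i, |x i - y i| ≤ d) :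
    softmax x k - softmax y k ≤ 2 * d := by
  have : Nonempty ι := ⟨k⟩
  have hx := sum_exp_pos x
  have hy := sum_exp_pos y
  have h1 : Real.exp (-(2 * d)) * softmax x k ≤ softmax y k := by
    have a : Real.exp (x k) * Real.exp (-d) ≤ Real.exp (y k) := by
      rw [← Real.exp_add]
      exact Real.exp_le_exp.2 (by linarith [abs_le.1 (h k)])
    have b : (∑ i, Real.exp (y i)) * Real.exp (-d) ≤ ∑ i, Real.exp (x i) := by
      rw [Finset.sum_mul]
      refine Finset.sum_le_sum fun i _ => ?_
      rw [← Real.exp_add]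
      exact Real.exp_le_exp.2 (by linarith [abs_le.1 (h i)])
    unfold softmax
    rw [le_div_iff₀ hy, show -(2 * d) = -d + -d by ring, Real.exp_add]
    calc Real.exp (-d) * Real.exp (-d) * (Real.exp (x k) / ∑ i, Real.exp (x i))
          * ∑ i, Real.exp (y i)
        = (Real.exp (x k) * Real.exp (-d))
          * (((∑ i, Real.exp (y i)) * Real.exp (-d)) / ∑ i, Real.exp (x i)) := by ring
      _ ≤ Real.exp (y k) * 1 := by
        gcongr
        rw [div_le_one hx]
        exact b
      _ = _ := mul_one _
  have h2 := Real.add_one_le_exp (-(2 * d))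
  have h3 := softmax_pos x k
  have h4 := softmax_le_one x k
  have hd : 0 ≤ d := (abs_nonneg _).trans (h k)
  nlinarith [mul_le_mul_of_nonneg_right h2 h3.le]

lemma abs_softmax_sub_le (x y : ι → ℝ) (k : ι) {d : ℝ} (h : ∀ i, |x i - y i| ≤ d) :
    |softmax x k - softmax y k| ≤ 2 * d :=
  abs_sub_le_iff.2 ⟨softmax_sub_le x y k h,
    softmax_sub_le y x k fun i => by rw [abs_sub_comm]; exact h i⟩

end Softmax

/-! ### Random recursions with small steps and differential equations -/

section Euler

/-- Global existence for a bounded Lipschitz vector field. -/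
lemma exists_solution {E : Type*} [NormedAddCommGroup E] [NormedSpace ℝ E] [CompleteSpace E]
    (F : E → E) {B L : ℝ} (hB : ∀ z, ‖F z‖ ≤ B) (hL0 : 0 ≤ L)
    (hL : ∀ z z', ‖F z - F z'‖ ≤ L * ‖z - z'‖) {S : ℝ} (hS : 0 ≤ S) :
    ∃ ζ : ℝ → E, ζ 0 = 0 ∧
      ∀ s ∈ Set.Icc 0 S, HasDerivWithinAt ζ (F (ζ s)) (Set.Icc 0 S) s := by
  have hB0 : 0 ≤ B := (norm_nonneg _).trans (hB 0)
  -- A field bounded by `B` cannot carry the solution out of the ball of radius `B * S` in time `S`,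
  -- so the local theorem already covers the whole interval.
  have h : IsPicardLindelof (fun _ => F) (tmin := 0) (tmax := S) ⟨0, le_rfl, hS⟩ 0
      ⟨B * S, by positivity⟩ 0 ⟨B, hB0⟩ ⟨L, hL0⟩ := by
    refine IsPicardLindelof.of_time_independent (fun x _ => hB x) ?_ ?_
    · refine LipschitzWith.lipschitzOnWith (LipschitzWith.of_dist_le_mul fun x y => ?_)
      rw [dist_eq_norm, dist_eq_norm]
      exact hL x y
    · simp only [sub_zero, sub_self, max_eq_left hS, NNReal.coe_zero]
      exact le_rfl
  exact h.exists_eq_forall_mem_Icc_hasDerivWithinAt₀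

lemma norm_solution_sub_le {E : Type*} [NormedAddCommGroup E] [NormedSpace ℝ E]
    {F : E → E} {B : ℝ} (hB : ∀ z, ‖F z‖ ≤ B) {S : ℝ} {ζ : ℝ → E}
    (hζ : ∀ s ∈ Set.Icc 0 S, HasDerivWithinAt ζ (F (ζ s)) (Set.Icc 0 S) s)
    {s t : ℝ} (hs : 0 ≤ s) (hst : s ≤ t) (ht : t ≤ S) : ‖ζ t - ζ s‖ ≤ B * (t - s) := by
  refine norm_image_sub_le_of_norm_deriv_le_segment' (a := s) (b := t) (f' := fun u => F (ζ u))
    (fun x hx => ?_) (fun x _ => hB _) t ⟨hst, le_rfl⟩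
  exact (hζ x ⟨hs.trans hx.1, hx.2.trans ht⟩).mono (Set.Icc_subset_Icc hs ht)

/-- Mean value inequality for `ζ u - u • F (ζ s)`: its derivative `F (ζ u) - F (ζ s)` is at most `L
* (B * η)` on a step of length `η`. -/
lemma norm_solution_euler_le {E : Type*} [NormedAddCommGroup E] [NormedSpace ℝ E]
    {F : E → E} {B L : ℝ} (hB : ∀ z, ‖F z‖ ≤ B) (hL0 : 0 ≤ L)
    (hL : ∀ z z', ‖F z - F z'‖ ≤ L * ‖z - z'‖) {S : ℝ} {ζ : ℝ → E}
    (hζ : ∀ s ∈ Set.Icc 0 S, HasDerivWithinAt ζ (F (ζ s)) (Set.Icc 0 S) s)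
    {s η : ℝ} (hs : 0 ≤ s) (hη : 0 ≤ η) (ht : s + η ≤ S) :
    ‖ζ (s + η) - ζ s - η • F (ζ s)‖ ≤ L * B * η * η := by
  have hB0 : 0 ≤ B := (norm_nonneg _).trans (hB 0)
  have h := norm_image_sub_le_of_norm_deriv_le_segment' (a := s) (b := s + η)
    (f := fun u => ζ u - u • F (ζ s)) (f' := fun u => F (ζ u) - F (ζ s)) (C := L * B * η)
    (fun x hx => ?_) (fun x hx => ?_) (s + η) ⟨by linarith, le_rfl⟩
  · convert h using 2
    · rw [add_smul]
      abel
    · ring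
  · have h1 := (hζ x ⟨hs.trans hx.1, hx.2.trans ht⟩).mono (Set.Icc_subset_Icc hs ht)
    have h2 := ((hasDerivAt_id x).smul_const (F (ζ s))).hasDerivWithinAt
      (s := Set.Icc s (s + η))
    rw [one_smul] at h2
    exact h1.sub h2
  · refine (hL _ _).trans ?_
    have := norm_solution_sub_le hB hζ hs hx.1 (hx.2.le.trans ht)
    rw [mul_assoc]
    have h3 : x - s ≤ η := by linarith [hx.2]
    gcongr
    exact this.trans (by gcongr)

variable {R : Type} [Fintype R] [Nonempty R] {T : ℕ} {ι : Type*} [Fintype ι]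

/-- A random recursion with small steps, whose drift is close to the vector field `F`, stays
close to the solution `ζ` of the differential equation, in mean square. -/
lemma IsKernel.mean_sq_sub_solution_le {q : Fin T → (Fin T → R) → R → ℝ} (hq : IsKernel q)
    (Z : ℕ → (Fin T → R) → ι → ℝ) (D : Fin T → (Fin T → R) → R → ι → ℝ)
    {F : (ι → ℝ) → ι → ℝ} {B L S η θ : ℝ} {ζ : ℝ → ι → ℝ}
    (hB : ∀ z, ‖F z‖ ≤ B) (hL0 : 0 ≤ L) (hL : ∀ z z', ‖F z - F z'‖ ≤ L * ‖z - z'‖)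
    (hζ0 : ζ 0 = 0) (hζ : ∀ s ∈ Set.Icc 0 S, HasDerivWithinAt ζ (F (ζ s)) (Set.Icc 0 S) s)
    (hZ0 : ∀ ω, Z 0 ω = 0) (hZ : ∀ (t : Fin T) ω i, Z (t + 1) ω i = Z t ω i + D t ω (ω t) i)
    (hZp : ∀ t, Predictable t (Z t)) (hDp : ∀ t : Fin T, Predictable (t : ℕ) (D t))
    (hη : 0 < η) (hD : ∀ t ω r i, |D t ω r i| ≤ B * η)
    (hdrift : ∀ t ω i, |∑ r, q t ω r * D t ω r i - η * F (Z t ω) i| ≤ η * θ)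
    {t : ℕ} (ht : t ≤ T) (htS : η * t ≤ S) :
    mean (seqLaw q) (fun ω => ∑ i, (Z t ω i - ζ (η * t) i) ^ 2)
      ≤ Fintype.card ι * ((θ + L * B * η) ^ 2 + 4 * B ^ 2 * η) * S
        * Real.exp ((2 * L * Fintype.card ι + 1) * S) := by
  have hB0 : 0 ≤ B := (norm_nonneg _).trans (hB 0)
  set N : ℝ := (Fintype.card ι : ℝ) with hN
  have hN0 : 0 ≤ N := by positivity
  set K : ℝ := 2 * L * N + 1
  have hK : 0 ≤ K := by positivity
  set G : ℝ := N * ((θ + L * B * η) ^ 2 + 4 * B ^ 2 * η)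
  have hG : 0 ≤ G := by positivity
  set e : ℕ → ℝ := fun t => mean (seqLaw q) (fun ω => ∑ i, (Z t ω i - ζ (η * t) i) ^ 2) with he
  -- The mean square error obeys a linear recursion. The drift mismatch and the Euler error enter
  -- through the cross term, weighted by `η`; the noise enters only through squared increments of
  -- order `η ^ 2`.
  have step : ∀ k, k < t → e (k + 1) ≤ (1 + K * η) * e k + G * η := by
    intro k hk
    let j : Fin T := ⟨k, by omega⟩
    have hkS : η * k + η ≤ S := by
      have : (k : ℝ) + 1 ≤ t := by exact_mod_cast hk
      nlinarith
    have hk0 : 0 ≤ η * k := by positivity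
    have hcast : η * ((k + 1 : ℕ) : ℝ) = η * k + η := by push_cast; ring
    have main : e (k + 1) ≤ mean (seqLaw q)
        (fun ω => (1 + K * η) * (∑ i, (Z k ω i - ζ (η * k) i) ^ 2) + G * η) := by
      refine hq.mean_le j (fun ω r => ∑ i, (Z k ω i + D j ω r i - ζ (η * k + η) i) ^ 2) ?_ ?_ ?_
      · intro ω ω' h
        ext r
        simp only [hDp j _ _ h, hZp k _ _ h]
      · intro ω
        refine le_of_eq ?_
        rw [hcast]
        exact Finset.sum_congr rfl fun i _ => by rw [← hZ j ω i]
      · intro ω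
        set d : ι → ℝ := fun i => Z k ω i - ζ (η * k) i with hd
        set c : ι → ℝ := fun i => ζ (η * k + η) i - ζ (η * k) i with hc
        -- The Lipschitz bound is in the sup norm, the error in the Euclidean one; this comparison
        -- lets the recursion close.
        have hnd : ‖d‖ ^ 2 ≤ ∑ i, d i ^ 2 := by
          have h0 : 0 ≤ ∑ i, d i ^ 2 := Finset.sum_nonneg fun i _ => sq_nonneg _
          have : ‖d‖ ≤ Real.sqrt (∑ i, d i ^ 2) := by
            refine (pi_norm_le_iff_of_nonneg (Real.sqrt_nonneg _)).2 fun i => ?_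
            refine Real.le_sqrt_of_sq_le ?_
            rw [Real.norm_eq_abs, sq_abs]
            exact Finset.single_le_sum (f := fun i => d i ^ 2) (fun i _ => sq_nonneg _)
              (Finset.mem_univ i)
          calc ‖d‖ ^ 2 ≤ Real.sqrt (∑ i, d i ^ 2) ^ 2 := by gcongr
            _ = _ := Real.sq_sqrt h0
        have hcB : ∀ i, |c i| ≤ B * η := fun i => by
          have := norm_solution_sub_le hB hζ hk0 (by linarith) hkS
          rw [add_sub_cancel_left] at this
          exact (norm_le_pi_norm (ζ (η * k + η) - ζ (η * k)) i).trans this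
        have hcF : ∀ i, |c i - η * F (ζ (η * k)) i| ≤ L * B * η * η := fun i =>
          (norm_le_pi_norm (ζ (η * k + η) - ζ (η * k) - η • F (ζ (η * k))) i).trans
            (norm_solution_euler_le hB hL0 hL hζ hk0 hη.le hkS)
        have hFd : ∀ i, |F (Z k ω) i - F (ζ (η * k)) i| ≤ L * ‖d‖ := fun i =>
          (norm_le_pi_norm (F (Z k ω) - F (ζ (η * k))) i).trans (hL _ _)
        have hone : ∀ i, ∑ r, q j ω r * (Z k ω i + D j ω r i - ζ (η * k + η) i) ^ 2
            ≤ d i ^ 2 + η * (2 * L * ‖d‖ ^ 2 + d i ^ 2 + (θ + L * B * η) ^ 2)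
              + 4 * B ^ 2 * η * η := by
          intro i
          have h1 : ∑ r, q j ω r * (Z k ω i + D j ω r i - ζ (η * k + η) i) ^ 2
              = (∑ r, q j ω r) * d i ^ 2
                + 2 * d i * (∑ r, q j ω r * D j ω r i - (∑ r, q j ω r) * c i)
                + ∑ r, q j ω r * (D j ω r i - c i) ^ 2 := by
            rw [Finset.sum_mul, Finset.sum_mul, ← Finset.sum_sub_distrib, Finset.mul_sum,
              ← Finset.sum_add_distrib, ← Finset.sum_add_distrib]
            refine Finset.sum_congr rfl fun r _ => ?_
            simp only [hd, hc]
            ring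
          rw [h1, hq.sum_eq_one, one_mul, one_mul]
          have h2 : ∑ r, q j ω r * (D j ω r i - c i) ^ 2 ≤ 4 * B ^ 2 * η * η := by
            calc _ ≤ ∑ r, q j ω r * (2 * B * η) ^ 2 := by
                  refine Finset.sum_le_sum fun r _ => ?_
                  refine mul_le_mul_of_nonneg_left ?_ (hq.nonneg _ _ _)
                  refine sq_le_sq' ?_ ?_ <;>
                    linarith [abs_le.1 (hcB i), abs_le.1 (hD j ω r i)]
              _ = _ := by
                  rw [← Finset.sum_mul, hq.sum_eq_one]
                  ring
          have h3 : |∑ r, q j ω r * D j ω r i - c i| ≤ η * (L * ‖d‖ + (θ + L * B * η)) := by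
            have a1 := abs_le.1 (hdrift j ω i)
            have a2 := abs_le.1 (hcF i)
            have a3 := abs_le.1 (hFd i)
            have a4 := mul_le_mul_of_nonneg_left a3.1 hη.le
            have a5 := mul_le_mul_of_nonneg_left a3.2 hη.le
            have a6 : Z (j : ℕ) ω = Z k ω := rfl
            rw [a6] at a1
            rw [abs_le]
            constructor <;> nlinarith
          have h4 : |d i| ≤ ‖d‖ := norm_le_pi_norm d i
          have h5 : 2 * d i * (∑ r, q j ω r * D j ω r i - c i)
              ≤ 2 * |d i| * (η * (L * ‖d‖ + (θ + L * B * η))) := by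
            refine (le_abs_self _).trans ?_
            rw [abs_mul, abs_mul, abs_two]
            gcongr
          have h6 : 2 * |d i| * (η * (L * ‖d‖ + (θ + L * B * η)))
              ≤ η * (2 * L * ‖d‖ ^ 2 + d i ^ 2 + (θ + L * B * η) ^ 2) := by
            have b1 : |d i| * ‖d‖ ≤ ‖d‖ ^ 2 := by
              rw [sq]
              gcongr
            have b2 : 2 * |d i| * (θ + L * B * η) ≤ d i ^ 2 + (θ + L * B * η) ^ 2 := by
              have := two_mul_le_add_sq (|d i|) (θ + L * B * η)
              rwa [sq_abs] at this
            have b3 := mul_le_mul_of_nonneg_left b1 hL0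
            have : 2 * |d i| * (L * ‖d‖ + (θ + L * B * η))
                ≤ 2 * L * ‖d‖ ^ 2 + d i ^ 2 + (θ + L * B * η) ^ 2 := by nlinarith
            have := mul_le_mul_of_nonneg_left this hη.le
            linarith
          linarith
        calc ∑ r, q j ω r * ∑ i, (Z k ω i + D j ω r i - ζ (η * k + η) i) ^ 2
            = ∑ i, ∑ r, q j ω r * (Z k ω i + D j ω r i - ζ (η * k + η) i) ^ 2 := by
              simp only [Finset.mul_sum]
              exact Finset.sum_comm
          _ ≤ ∑ i, (d i ^ 2 + η * (2 * L * ‖d‖ ^ 2 + d i ^ 2 + (θ + L * B * η) ^ 2)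
              + 4 * B ^ 2 * η * η) := Finset.sum_le_sum fun i _ => hone i
          _ = ∑ i, d i ^ 2 + η * (2 * L * N * ‖d‖ ^ 2 + ∑ i, d i ^ 2) + G * η := by
              simp only [Finset.sum_add_distrib, ← Finset.mul_sum, Finset.sum_const,
                Finset.card_univ, nsmul_eq_mul, ← hN, G]
              ring
          _ ≤ ∑ i, d i ^ 2 + η * (2 * L * N * ∑ i, d i ^ 2 + ∑ i, d i ^ 2) + G * η := by
              gcongr
          _ = (1 + K * η) * ∑ i, d i ^ 2 + G * η := by
              simp only [K]
              ring
    rw [mean_add, mean_const hq.sum_seqLaw, mean_const_mul] at main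
    exact main
  have hS : 0 ≤ S := le_trans (by positivity) htS
  -- Discrete Grönwall inequality, with `1 + K * η ≤ exp (K * η)`.
  have ind : ∀ k, k ≤ t → e k ≤ G * (η * k) * Real.exp (K * (η * k)) := by
    intro k
    induction k with
    | zero =>
      intro _
      simp [he, hZ0, hζ0, mean]
    | succ k ih =>
      intro hk
      have h1 := ih (by omega)
      have h2 := step k (by omega)
      have h3 : 1 + K * η ≤ Real.exp (K * η) := by linarith [Real.add_one_le_exp (K * η)]
      have h4 : (1:ℝ) ≤ Real.exp (K * (η * k) + K * η) := Real.one_le_exp (by positivity)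
      have h5 : 0 ≤ e k := mean_nonneg hq.seqLaw_nonneg fun ω =>
        Finset.sum_nonneg fun i _ => sq_nonneg _
      have h6 : (1 + K * η) * e k
          ≤ Real.exp (K * η) * (G * (η * k) * Real.exp (K * (η * k))) := by gcongr
      have h7 : G * η ≤ G * η * Real.exp (K * (η * k) + K * η) :=
        le_mul_of_one_le_right (by positivity) h4
      refine h2.trans ((add_le_add h6 h7).trans (le_of_eq ?_))
      push_cast
      rw [show K * (η * (k + 1)) = K * (η * k) + K * η by ring, Real.exp_add]
      ring
  refine (ind t le_rfl).trans ?_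
  gcongr

end Euler

/-! ### Utilities and log-weights -/

section Utility

lemma utility_nonneg {v b c : ℝ} (h : b ≤ v) : 0 ≤ utility v b c := by
  unfold utility
  split_ifs <;> linarith

lemma utility_le {v b c : ℝ} (hv : 0 ≤ v) (hc : 0 ≤ c) : utility v b c ≤ v := by
  unfold utility
  split_ifs <;> linarith

/-- Raising a bid that stays within the value can only turn a loss into a tie or a win, and a win at
a price of at most the value does no harm. -/
lemma utility_mono {v b b' c : ℝ} (h : b ≤ b') (hb : b' ≤ v) : utility v b c ≤ utility v b' c := by
  unfold utility
  split_ifs <;> first | linarith | grind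

variable {ε : ℝ} {N M : ℕ}

lemma bid_nonneg (hε : 0 < ε) (k : Fin (N + 1)) : 0 ≤ bid ε k := by
  unfold bid
  positivity

lemma bid_le (hε : 0 < ε) (k : Fin (N + 1)) : bid ε k ≤ N * ε := by
  unfold bid
  have : ((k : ℕ) : ℝ) ≤ N := by exact_mod_cast Nat.lt_succ_iff.1 k.2
  gcongr

lemma bid_lt_bid_iff (hε : 0 < ε) (k : Fin (N + 1)) (l : Fin (M + 1)) :
    bid ε k < bid ε l ↔ (k : ℕ) < l := by
  unfold bid
  rw [mul_lt_mul_iff_left₀ hε]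
  exact Nat.cast_lt

lemma bid_le_bid_iff (hε : 0 < ε) (k : Fin (N + 1)) (l : Fin (M + 1)) :
    bid ε k ≤ bid ε l ↔ (k : ℕ) ≤ l := by
  unfold bid
  rw [mul_le_mul_iff_left₀ hε]
  exact Nat.cast_le

/-- The logarithm of the update factor. -/
noncomputable def UpdateRule.logFactor (rule : UpdateRule) (η u : ℝ) : ℝ :=
  Real.log (rule.factor η u)

variable {rule : UpdateRule} {η u : ℝ}

lemma UpdateRule.one_le_factor (hη : 0 ≤ η) (hu : 0 ≤ u) : 1 ≤ rule.factor η u := by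
  have : 0 ≤ η * u := mul_nonneg hη hu
  cases rule with
  | linear => simpa [UpdateRule.factor] using this
  | hedge => exact Real.one_le_exp this

lemma UpdateRule.exp_logFactor (hη : 0 ≤ η) (hu : 0 ≤ u) :
    Real.exp (rule.logFactor η u) = rule.factor η u :=
  Real.exp_log (zero_lt_one.trans_le (one_le_factor hη hu))

lemma UpdateRule.logFactor_nonneg (hη : 0 ≤ η) (hu : 0 ≤ u) : 0 ≤ rule.logFactor η u :=
  Real.log_nonneg (one_le_factor hη hu)

lemma UpdateRule.logFactor_le (hη : 0 ≤ η) (hu : 0 ≤ u) : rule.logFactor η u ≤ η * u := by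
  have h : 0 ≤ η * u := mul_nonneg hη hu
  cases rule with
  | linear =>
    have := Real.log_le_sub_one_of_pos (x := 1 + η * u) (by linarith)
    simp only [logFactor, factor]
    linarith
  | hedge => simp [logFactor, factor]

/-- With `logFactor_le`, this makes the two rules agree to first order in `η`; only this matters in
the limit. -/
lemma UpdateRule.sub_sq_le_logFactor (hη : 0 ≤ η) (hu : 0 ≤ u) :
    η * u - (η * u) ^ 2 ≤ rule.logFactor η u := by
  have h : 0 ≤ η * u := mul_nonneg hη hu
  cases rule with
  | linear =>
    have h1 := Real.one_sub_inv_le_log_of_pos (x := 1 + η * u) (by linarith)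
    simp only [logFactor, factor]
    refine le_trans ?_ h1
    rw [show 1 - (1 + η * u)⁻¹ = η * u / (1 + η * u) by field_simp; ring,
      le_div_iff₀ (by linarith)]
    nlinarith [mul_nonneg h (mul_nonneg h h)]
  | hedge =>
    simp only [logFactor, factor, Real.log_exp]
    nlinarith [sq_nonneg (η * u)]

lemma UpdateRule.logFactor_mono (hη : 0 ≤ η) {u' : ℝ} (hu : 0 ≤ u) (h : u ≤ u') :
    rule.logFactor η u ≤ rule.logFactor η u' := by
  have := mul_le_mul_of_nonneg_left h hη
  refine Real.log_le_log (zero_lt_one.trans_le (one_le_factor hη hu)) ?_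
  cases rule with
  | linear => simpa [factor] using this
  | hedge => exact Real.exp_le_exp.2 this

/-- The logarithm of the weight of the bid `k` after `t` rounds. -/
noncomputable def logWeight (rule : UpdateRule) (η ε : ℝ) {N M T : ℕ} (opp : Fin T → Fin (M + 1))
    (t : ℕ) (k : Fin (N + 1)) : ℝ :=
  ∑ s ∈ Finset.univ.filter (fun s : Fin T => (s : ℕ) < t), rule.logFactor η (utility (N * ε) (bid ε k) (bid ε (opp s)))

variable {T : ℕ} (opp : Fin T → Fin (M + 1))

lemma logWeight_zero (k : Fin (N + 1)) : logWeight rule η ε opp 0 k = 0 := by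
  simp [logWeight]

lemma logWeight_succ (t : Fin T) (k : Fin (N + 1)) :
    logWeight rule η ε opp (t + 1) k = logWeight rule η ε opp t k
      + rule.logFactor η (utility (N * ε) (bid ε k) (bid ε (opp t))) := by
  have h : (Finset.univ.filter fun s : Fin T => (s : ℕ) < t + 1)
      = insert t (Finset.univ.filter fun s : Fin T => (s : ℕ) < t) := by
    ext s
    simp only [Finset.mem_filter_univ, Finset.mem_insert, Fin.ext_iff]
    omega
  rw [logWeight, h, Finset.sum_insert (by simp), add_comm]
  rfl

lemma logWeight_congr {opp opp' : Fin T → Fin (M + 1)} {t : ℕ}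
    (h : ∀ s : Fin T, (s : ℕ) < t → opp s = opp' s) (k : Fin (N + 1)) :
    logWeight rule η ε opp t k = logWeight rule η ε opp' t k :=
  Finset.sum_congr rfl fun s hs => by rw [h s (Finset.mem_filter.1 hs).2]

/-- Both rules become a softmax of additive log-weights; from here on only the increments
distinguish them. -/
lemma mixed_eq_softmax (hη : 0 ≤ η) (hε : 0 < ε) (t : Fin T) (k : Fin (N + 1)) :
    mixed rule η ε opp t k = softmax (logWeight rule η ε opp t) k := by
  have h : ∀ k : Fin (N + 1), weight rule η ε opp t k = Real.exp (logWeight rule η ε opp t k) := by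
    intro k
    rw [logWeight, Real.exp_sum, weight]
    refine Finset.prod_congr (by ext s; simp only [Finset.mem_Iio, Finset.mem_filter_univ]; rfl) fun s _ => ?_
    rw [UpdateRule.exp_logFactor hη (utility_nonneg (bid_le hε k))]
  simp [mixed, softmax, h]

end Utility

/-! ### Decay of the high player's losing bids and freezing of the low player's weights -/

/-- The parameters of the dynamics, for a given horizon. -/
structure Dynamics (n m : ℕ) where
  rule₁ : UpdateRule
  rule₂ : UpdateRule
  η₁ : ℝ
  η₂ : ℝ
  ε : ℝ
  η₁_pos : 0 < η₁
  η₂_pos : 0 < η₂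
  ε_pos : 0 < ε

namespace Dynamics

variable {n m : ℕ} (A : Dynamics n m)

/-- The change of the log-weight of the high player's bid `k` against the bid `j`. -/
noncomputable def highGain (k : Fin (n + 1)) (j : Fin (m + 1)) : ℝ :=
  A.rule₁.logFactor A.η₁ (utility (n * A.ε) (bid A.ε k) (bid A.ε j))

/-- The change of the log-weight of the low player's bid `j` against the bid `k`. -/
noncomputable def lowGain (j : Fin (m + 1)) (k : Fin (n + 1)) : ℝ :=
  A.rule₂.logFactor A.η₂ (utility (m * A.ε) (bid A.ε j) (bid A.ε k))

lemma highGain_nonneg (k : Fin (n + 1)) (j : Fin (m + 1)) : 0 ≤ A.highGain k j :=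
  UpdateRule.logFactor_nonneg A.η₁_pos.le (utility_nonneg (bid_le A.ε_pos k))

lemma lowGain_nonneg (j : Fin (m + 1)) (k : Fin (n + 1)) : 0 ≤ A.lowGain j k :=
  UpdateRule.logFactor_nonneg A.η₂_pos.le (utility_nonneg (bid_le A.ε_pos j))

lemma value_nonneg (N : ℕ) : 0 ≤ N * A.ε := mul_nonneg N.cast_nonneg A.ε_pos.le

lemma highGain_le (k : Fin (n + 1)) (j : Fin (m + 1)) : A.highGain k j ≤ A.η₁ * (n * A.ε) :=
  (UpdateRule.logFactor_le A.η₁_pos.le (utility_nonneg (bid_le A.ε_pos k))).trans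
    (mul_le_mul_of_nonneg_left (utility_le (A.value_nonneg n) (bid_nonneg A.ε_pos j))
      A.η₁_pos.le)

lemma lowGain_le (j : Fin (m + 1)) (k : Fin (n + 1)) : A.lowGain j k ≤ A.η₂ * (m * A.ε) :=
  (UpdateRule.logFactor_le A.η₂_pos.le (utility_nonneg (bid_le A.ε_pos j))).trans
    (mul_le_mul_of_nonneg_left (utility_le (A.value_nonneg m) (bid_nonneg A.ε_pos k))
      A.η₂_pos.le)

lemma abs_logFactor_sub_le {rule : UpdateRule} {η u V : ℝ} (hη : 0 ≤ η) (hu : 0 ≤ u)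
    (huV : u ≤ V) : |rule.logFactor η u - η * u| ≤ (η * V) ^ 2 := by
  have h1 := UpdateRule.logFactor_le (rule := rule) hη hu
  have h2 := UpdateRule.sub_sq_le_logFactor (rule := rule) hη hu
  have h3 : (η * u) ^ 2 ≤ (η * V) ^ 2 := by gcongr
  rw [abs_le]
  constructor <;> linarith [sq_nonneg (η * V)]

lemma lowGain_mono {j j' : Fin (m + 1)} (h : j ≤ j') (k : Fin (n + 1)) :
    A.lowGain j k ≤ A.lowGain j' k :=
  UpdateRule.logFactor_mono A.η₂_pos.le (utility_nonneg (bid_le A.ε_pos j))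
    (utility_mono ((bid_le_bid_iff A.ε_pos j j').2 h) (bid_le A.ε_pos j'))

/-- A low player who is certainly outbid learns nothing: this is what stops his weights. -/
lemma lowGain_eq_zero {j : Fin (m + 1)} {k : Fin (n + 1)} (h : m < (k : ℕ)) :
    A.lowGain j k = 0 := by
  have h1 : bid A.ε j < bid A.ε k := (bid_lt_bid_iff A.ε_pos j k).2 (by have := j.2; omega)
  have h2 : utility (m * A.ε) (bid A.ε j) (bid A.ε k) = 0 := by
    rw [utility, if_neg h1.not_gt, if_neg h1.ne]
  rw [lowGain, h2]
  cases A.rule₂ <;> simp [UpdateRule.logFactor, UpdateRule.factor]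

lemma highGain_eq {k l : Fin (n + 1)} (hk : m < (k : ℕ)) (hl : m < (l : ℕ)) (j : Fin (m + 1)) :
    A.highGain k j = A.highGain l j := by
  have h1 : bid A.ε j < bid A.ε k := (bid_lt_bid_iff A.ε_pos j k).2 (by have := j.2; omega)
  have h2 : bid A.ε j < bid A.ε l := (bid_lt_bid_iff A.ε_pos j l).2 (by have := j.2; omega)
  simp [highGain, utility, h1, h2]

lemma highGain_le_last (k : Fin (n + 1)) (j : Fin (m + 1)) :
    A.highGain k j ≤ A.highGain (Fin.last n) j :=
  UpdateRule.logFactor_mono A.η₁_pos.le (utility_nonneg (bid_le A.ε_pos k))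
    (utility_mono ((bid_le_bid_iff A.ε_pos k (Fin.last n)).2 (by simpa using k.is_le))
      (bid_le A.ε_pos _))

/-- Put `a = (n - m) * ε`. Against the bid `w`, a bid `k ≤ m` at best ties and gains at most `η₁ * a
/ 2`, while `v` gains at least `η₁ * a - (η₁ * a) ^ 2`, which is at least `3 / 4 * (η₁ * a)` for `η₁
* a ≤ 1 / 4`. -/
lemma highGain_sub_last_le (hmn : m < n) (hη : A.η₁ * ((n - m) * A.ε) ≤ 1 / 4) {k : Fin (n + 1)}
    (hk : (k : ℕ) ≤ m) :
    A.highGain k (Fin.last m) - A.highGain (Fin.last n) (Fin.last m)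
      ≤ -(A.η₁ * ((n - m) * A.ε) / 4) := by
  have hmn' : (m : ℝ) < n := by exact_mod_cast hmn
  have ha : 0 < ((n : ℝ) - m) * A.ε := mul_pos (by linarith) A.ε_pos
  have h1 : ¬ bid A.ε (Fin.last m) < bid A.ε k := by
    rw [bid_lt_bid_iff A.ε_pos]
    simpa using hk
  have h2 : bid A.ε (Fin.last m) < bid A.ε (Fin.last n) := by
    rw [bid_lt_bid_iff A.ε_pos]
    simpa using hmn
  have hb : (n : ℝ) * A.ε - bid A.ε (Fin.last m) = (n - m) * A.ε := by
    simp [bid]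
    ring
  have h3 : utility (n * A.ε) (bid A.ε k) (bid A.ε (Fin.last m)) ≤ (n - m) * A.ε / 2 := by
    rw [utility, if_neg h1, hb]
    split_ifs <;> linarith
  have h4 : utility (n * A.ε) (bid A.ε (Fin.last n)) (bid A.ε (Fin.last m)) = (n - m) * A.ε := by
    rw [utility, if_pos h2, hb]
  have h5 := UpdateRule.logFactor_le (rule := A.rule₁) A.η₁_pos.le
    (utility_nonneg (c := bid A.ε (Fin.last m)) (bid_le A.ε_pos k))
  have h6 := UpdateRule.sub_sq_le_logFactor (rule := A.rule₁) A.η₁_pos.le ha.le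
  have h7 := mul_le_mul_of_nonneg_left h3 A.η₁_pos.le
  rw [highGain, highGain, h4]
  have h8 : 0 < A.η₁ * ((n - m) * A.ε) := mul_pos A.η₁_pos ha
  nlinarith

variable {T : ℕ}

/-- The log-weights of the high player's bids after `t` rounds. -/
noncomputable def highWeight (t : ℕ) (ω : History n m T) : Fin (n + 1) → ℝ :=
  logWeight A.rule₁ A.η₁ A.ε (fun s => (ω s).1.2) t

/-- The log-weights of the low player's bids after `t` rounds. -/
noncomputable def lowWeight (t : ℕ) (ω : History n m T) : Fin (m + 1) → ℝ :=
  logWeight A.rule₂ A.η₂ A.ε (fun s => (ω s).1.1) t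

/-- The conditional law of a round. -/
noncomputable def kernel (t : Fin T) (ω : History n m T) (r : Round n m) : ℝ :=
  softmax (A.highWeight t ω) r.1.1 * softmax (A.lowWeight t ω) r.1.2 * (1 / 2)

lemma highWeight_eq_sum (t : ℕ) (ω : History n m T) (k : Fin (n + 1)) :
    A.highWeight t ω k
      = ∑ s ∈ Finset.univ.filter (fun s : Fin T => (s : ℕ) < t), A.highGain k (ω s).1.2 :=
  rfl

lemma lowWeight_eq_sum (t : ℕ) (ω : History n m T) (j : Fin (m + 1)) :
    A.lowWeight t ω j
      = ∑ s ∈ Finset.univ.filter (fun s : Fin T => (s : ℕ) < t), A.lowGain j (ω s).1.1 :=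
  rfl

lemma highWeight_succ (t : Fin T) (ω : History n m T) (k : Fin (n + 1)) :
    A.highWeight (t + 1) ω k = A.highWeight t ω k + A.highGain k (ω t).1.2 :=
  logWeight_succ _ t k

lemma lowWeight_succ (t : Fin T) (ω : History n m T) (j : Fin (m + 1)) :
    A.lowWeight (t + 1) ω j = A.lowWeight t ω j + A.lowGain j (ω t).1.1 :=
  logWeight_succ _ t j

lemma highWeight_predictable (t : ℕ) : Predictable t (A.highWeight t (T := T)) :=
  fun _ _ h => funext fun k => logWeight_congr (fun s hs => by rw [h s hs]) k

lemma lowWeight_predictable (t : ℕ) : Predictable t (A.lowWeight t (T := T)) :=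
  fun _ _ h => funext fun k => logWeight_congr (fun s hs => by rw [h s hs]) k

lemma highWeight_zero (ω : History n m T) : A.highWeight 0 ω = 0 :=
  funext fun _ => logWeight_zero _ _

lemma lowWeight_zero (ω : History n m T) : A.lowWeight 0 ω = 0 :=
  funext fun _ => logWeight_zero _ _

/-- The law of the dynamics. -/
noncomputable def P (T : ℕ) : History n m T → ℝ := seqLaw A.kernel

lemma law_eq : law A.rule₁ A.rule₂ A.η₁ A.η₂ A.ε = A.P T := by
  ext ω
  simp only [law, P, seqLaw, kernel, mixed_eq_softmax _ A.η₁_pos.le A.ε_pos,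
    mixed_eq_softmax _ A.η₂_pos.le A.ε_pos]
  rfl

lemma sum_kernel_mul (t : Fin T) (ω : History n m T) (f : Fin (n + 1) × Fin (m + 1) → ℝ) :
    ∑ r, A.kernel t ω r * f r.1
      = ∑ k, ∑ j, softmax (A.highWeight t ω) k * softmax (A.lowWeight t ω) j * f (k, j) := by
  rw [Fintype.sum_prod_type, Fintype.sum_prod_type]
  refine Finset.sum_congr rfl fun k _ => Finset.sum_congr rfl fun j _ => ?_
  simp only [kernel, Finset.sum_const, Finset.card_univ, Fintype.card_bool, nsmul_eq_mul]
  push_cast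
  ring

lemma sum_kernel_high (t : Fin T) (ω : History n m T) (f : Fin (n + 1) → ℝ) :
    ∑ r, A.kernel t ω r * f r.1.1 = ∑ k, softmax (A.highWeight t ω) k * f k := by
  rw [A.sum_kernel_mul t ω fun b => f b.1]
  refine Finset.sum_congr rfl fun k _ => ?_
  dsimp only
  rw [← Finset.sum_mul, ← Finset.mul_sum, sum_softmax, mul_one]

lemma sum_kernel_low (t : Fin T) (ω : History n m T) (f : Fin (m + 1) → ℝ) :
    ∑ r, A.kernel t ω r * f r.1.2 = ∑ j, softmax (A.lowWeight t ω) j * f j := by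
  rw [A.sum_kernel_mul t ω fun b => f b.2, Finset.sum_comm]
  refine Finset.sum_congr rfl fun j _ => ?_
  dsimp only
  rw [← Finset.sum_mul, ← Finset.sum_mul, sum_softmax, one_mul]

lemma isKernel : IsKernel (A.kernel (T := T)) where
  nonneg t ω r := by
    have := softmax_pos (A.highWeight t ω) r.1.1
    have := softmax_pos (A.lowWeight t ω) r.1.2
    unfold kernel
    positivity
  sum_eq_one t ω := by
    have := A.sum_kernel_high t ω fun _ => 1
    simpa [sum_softmax] using this
  predictable t ω ω' h := by
    ext r
    simp only [kernel, A.highWeight_predictable _ _ _ h, A.lowWeight_predictable _ _ _ h]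

lemma P_nonneg (ω : History n m T) : 0 ≤ A.P T ω := A.isKernel.seqLaw_nonneg ω

lemma sum_P : ∑ ω, A.P T ω = 1 := A.isKernel.sum_seqLaw

lemma lowWeight_mono (t : ℕ) (ω : History n m T) : Monotone (A.lowWeight t ω) := by
  intro _ _ h
  rw [lowWeight_eq_sum, lowWeight_eq_sum]
  exact Finset.sum_le_sum fun s _ => A.lowGain_mono h (ω s).1.1

lemma lowWeight_mono_time {s t : ℕ} (h : s ≤ t) (ω : History n m T) (j : Fin (m + 1)) :
    A.lowWeight s ω j ≤ A.lowWeight t ω j := by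
  rw [lowWeight_eq_sum, lowWeight_eq_sum]
  refine Finset.sum_le_sum_of_subset_of_nonneg (fun i hi => ?_)
    fun i _ _ => A.lowGain_nonneg j (ω i).1.1
  simp only [Finset.mem_filter_univ] at hi ⊢
  omega

lemma highWeight_eq {k l : Fin (n + 1)} (hk : m < (k : ℕ)) (hl : m < (l : ℕ)) (t : ℕ)
    (ω : History n m T) : A.highWeight t ω k = A.highWeight t ω l := by
  rw [highWeight_eq_sum, highWeight_eq_sum]
  exact Finset.sum_congr rfl fun s _ => A.highGain_eq hk hl (ω s).1.2

/-- The weight of the high player's bid `k` relative to his highest bid. -/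
noncomputable def ratio (k : Fin (n + 1)) (t : ℕ) (ω : History n m T) : ℝ :=
  Real.exp (A.highWeight t ω k - A.highWeight t ω (Fin.last n))

/-- The rate, per unit of `η₁ t`, at which the high player's losing bids lose weight. -/
noncomputable def rate : ℝ := ((n : ℝ) - m) * A.ε / (8 * (m + 1))

lemma rate_pos (hmn : m < n) : 0 < A.rate := by
  have : (m : ℝ) < n := by exact_mod_cast hmn
  have := A.ε_pos
  exact div_pos (mul_pos (by linarith) this) (by positivity)

lemma exp_neg_le {x : ℝ} (h0 : 0 ≤ x) (h1 : x ≤ 1) : Real.exp (-x) ≤ 1 - x / 2 := by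
  rw [Real.exp_neg, inv_le_comm₀ (Real.exp_pos _) (by linarith)]
  refine le_trans ?_ (Real.add_one_le_exp x)
  rw [inv_le_iff_one_le_mul₀ (by linarith)]
  nlinarith

lemma rate_mul_le_one (hη : A.η₁ * ((n - m) * A.ε) ≤ 1 / 4) : A.rate * A.η₁ ≤ 1 := by
  rw [rate, div_mul_eq_mul_div, div_le_one (by positivity)]
  have : (0 : ℝ) ≤ m := m.cast_nonneg
  nlinarith

/-- The relative weight never increases, as `v` earns at least as much as any other bid, and it
contracts strictly when the low player bids `w`, which has conditional probability at least `1 / (m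
+ 1)` whatever the past. -/
lemma mean_ratio_le (hmn : m < n) (hη : A.η₁ * ((n - m) * A.ε) ≤ 1 / 4) {k : Fin (n + 1)}
    (hk : (k : ℕ) ≤ m) {t : ℕ} (ht : t ≤ T) :
    mean (A.P T) (A.ratio k t) ≤ (1 - A.rate * A.η₁) ^ t := by
  induction t with
  | zero =>
    have : A.ratio k 0 (T := T) = fun _ => 1 := by
      ext ω
      simp [ratio, highWeight_zero]
    rw [this, mean_const A.sum_P]
    simp
  | succ t ih =>
    let i : Fin T := ⟨t, by omega⟩
    set x := A.η₁ * (((n : ℝ) - m) * A.ε) / 4 with hx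
    have hx0 : 0 ≤ x := by
      have : (m : ℝ) < n := by exact_mod_cast hmn
      have h1 : 0 < ((n : ℝ) - m) * A.ε := mul_pos (by linarith) A.ε_pos
      have h2 := mul_pos A.η₁_pos h1
      positivity
    -- The `8` in `rate` is the `4` of `highGain_sub_last_le` times the `2` of `exp_neg_le`; the
    -- factor `m + 1` is the low player's number of bids.
    have hrate : A.rate * A.η₁ = x / 2 * (1 / (m + 1)) := by
      rw [rate, hx]
      field_simp
      ring
    have step : mean (A.P T) (A.ratio k (t + 1))
        ≤ mean (A.P T) (fun ω => (1 - A.rate * A.η₁) * A.ratio k t ω) := by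
      refine A.isKernel.mean_le i (fun ω r => A.ratio k t ω *
        Real.exp (A.highGain k r.1.2 - A.highGain (Fin.last n) r.1.2)) ?_ ?_ ?_
      · intro ω ω' h
        ext r
        simp only [ratio, A.highWeight_predictable t _ _ h]
      · intro ω
        refine le_of_eq ?_
        rw [ratio, ratio, ← Real.exp_add, A.highWeight_succ i ω k,
          A.highWeight_succ i ω (Fin.last n)]
        congr 1
        ring
      · intro ω
        have h1 : ∑ r, A.kernel i ω r * (A.ratio k t ω *
            Real.exp (A.highGain k r.1.2 - A.highGain (Fin.last n) r.1.2))
            = A.ratio k t ω * ∑ j, softmax (A.lowWeight t ω) j *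
              Real.exp (A.highGain k j - A.highGain (Fin.last n) j) := by
          have := A.sum_kernel_low i ω fun j => A.ratio k t ω *
            Real.exp (A.highGain k j - A.highGain (Fin.last n) j)
          rw [this, Finset.mul_sum]
          exact Finset.sum_congr rfl fun j _ => by ring
        rw [h1, mul_comm]
        refine mul_le_mul_of_nonneg_right ?_ (Real.exp_pos _).le
        calc ∑ j, softmax (A.lowWeight t ω) j *
              Real.exp (A.highGain k j - A.highGain (Fin.last n) j)
            ≤ ∑ j, (softmax (A.lowWeight t ω) j
              - if j = Fin.last m then softmax (A.lowWeight t ω) j * (x / 2) else 0) := by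
              refine Finset.sum_le_sum fun j _ => ?_
              have hs := (softmax_pos (A.lowWeight t ω) j).le
              by_cases hj : j = Fin.last m
              · rw [if_pos hj, ← mul_one_sub]
                refine mul_le_mul_of_nonneg_left ?_ hs
                refine le_trans ?_ (exp_neg_le hx0 (by linarith))
                rw [hj]
                exact Real.exp_le_exp.2 (A.highGain_sub_last_le hmn hη hk)
              · rw [if_neg hj, sub_zero]
                refine mul_le_of_le_one_right hs ?_
                exact Real.exp_le_one_iff.2 (by linarith [A.highGain_le_last k j])
          _ = 1 - softmax (A.lowWeight t ω) (Fin.last m) * (x / 2) := by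
              rw [Finset.sum_sub_distrib, sum_softmax, Finset.sum_ite_eq']
              simp
          _ ≤ 1 - A.rate * A.η₁ := by
              have h2 := inv_card_le_softmax (A.lowWeight t ω) (Fin.last m)
                fun l => A.lowWeight_mono t ω (Fin.le_last l)
              rw [Fintype.card_fin] at h2
              push_cast at h2
              rw [hrate]
              nlinarith
    rw [mean_const_mul] at step
    refine step.trans ?_
    rw [pow_succ, mul_comm]
    exact mul_le_mul_of_nonneg_right (ih (by omega)) (by linarith [A.rate_mul_le_one hη])

/-- A bound for the probability that the high player bids at most `m`. -/
noncomputable def losingMass (t : ℕ) (ω : History n m T) : ℝ :=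
  ∑ k ∈ Finset.univ.filter (fun k : Fin (n + 1) => (k : ℕ) ≤ m), A.ratio k t ω

lemma mean_losingMass_le (hmn : m < n) (hη : A.η₁ * ((n - m) * A.ε) ≤ 1 / 4) {t : ℕ}
    (ht : t ≤ T) : mean (A.P T) (A.losingMass t) ≤ (n + 1) * (1 - A.rate * A.η₁) ^ t := by
  have h0 : 0 ≤ 1 - A.rate * A.η₁ := by linarith [A.rate_mul_le_one hη]
  have := mean_sum (Finset.univ.filter fun k : Fin (n + 1) => (k : ℕ) ≤ m) (A.P T)
    fun k => A.ratio k t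
  unfold losingMass
  rw [this]
  calc _ ≤ ∑ k ∈ Finset.univ.filter (fun k : Fin (n + 1) => (k : ℕ) ≤ m), (1 - A.rate * A.η₁) ^ t :=
        Finset.sum_le_sum fun k hk => A.mean_ratio_le hmn hη (Finset.mem_filter.1 hk).2 ht
    _ ≤ ∑ k : Fin (n + 1), (1 - A.rate * A.η₁) ^ t :=
        Finset.sum_le_sum_of_subset_of_nonneg (Finset.subset_univ _) fun _ _ _ => by positivity
    _ = _ := by simp

/-- The low player gains only when the high player bids at most `m`, an event of probability at most
`losingMass`. Its means are dominated by a geometric series in `β = 1 - rate * η₁`, whose sum of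
order `1 / η₁` cancels the step size `η₂` up to the ratio `η₂ / η₁`. -/
lemma mean_lowWeight_sub_le (hmn : m < n) (hη : A.η₁ * ((n - m) * A.ε) ≤ 1 / 4) {s t : ℕ}
    (hst : s ≤ t) (ht : t ≤ T) (j : Fin (m + 1)) :
    mean (A.P T) (fun ω => A.lowWeight t ω j - A.lowWeight s ω j)
      ≤ A.η₂ / A.η₁ * (m * A.ε * (n + 1) / A.rate) * Real.exp (-(A.rate * (A.η₁ * s))) := by
  have hr := A.rate_pos hmn
  have hη1 := A.η₁_pos
  have hη2 := A.η₂_pos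
  have hε := A.ε_pos
  set β := 1 - A.rate * A.η₁ with hβ
  have h0 : 0 ≤ β := by linarith [A.rate_mul_le_one hη]
  set C := A.η₂ * (m * A.ε) * (n + 1) / (A.rate * A.η₁) with hC
  have hC0 : 0 ≤ C := by positivity
  -- `C` is chosen so that `C * (β ^ t - β ^ (t + 1))` is exactly the bound for the growth in round
  -- `t`.
  have main : mean (A.P T) (fun ω => A.lowWeight t ω j - A.lowWeight s ω j)
      ≤ C * (β ^ s - β ^ t) := by
    induction t, hst using Nat.le_induction with
    | base => simp [mean]
    | succ t hst ih =>
      let i : Fin T := ⟨t, by omega⟩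
      have step : mean (A.P T) (fun ω => A.lowWeight (t + 1) ω j - A.lowWeight s ω j)
          ≤ mean (A.P T) (fun ω => (A.lowWeight t ω j - A.lowWeight s ω j)
            + A.η₂ * (m * A.ε) * A.losingMass t ω) := by
        refine A.isKernel.mean_le i
          (fun ω r => (A.lowWeight t ω j - A.lowWeight s ω j) + A.lowGain j r.1.1) ?_ ?_ ?_
        · intro ω ω' h
          ext r
          simp only [A.lowWeight_predictable t _ _ h, (A.lowWeight_predictable s).mono hst _ _ h]
        · intro ω
          rw [A.lowWeight_succ i ω j]
          exact le_of_eq (by simp only [i]; ring)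
        · intro ω
          simp only [mul_add, Finset.sum_add_distrib, ← Finset.sum_mul,
            A.isKernel.sum_eq_one, one_mul]
          rw [A.sum_kernel_high i ω fun k => A.lowGain j k]
          gcongr
          rw [losingMass, Finset.mul_sum, Finset.sum_filter]
          refine Finset.sum_le_sum fun k _ => ?_
          split_ifs with hk
          · rw [mul_comm]
            refine mul_le_mul (A.lowGain_le j k) (softmax_le_exp_sub _ _ _) (softmax_pos _ _).le
              (by positivity)
          · rw [A.lowGain_eq_zero (by omega), mul_zero]
      rw [mean_add, mean_const_mul] at step
      have h1 := ih (by omega)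
      have h2 := A.mean_losingMass_le hmn hη (T := T) (t := t) (by omega)
      have h3 : C * (β ^ t - β ^ (t + 1)) = A.η₂ * (m * A.ε) * ((n + 1) * β ^ t) := by
        rw [hC, pow_succ, ← mul_one_sub, hβ]
        field_simp
        ring
      have h4 : A.η₂ * (m * A.ε) * mean (A.P T) (A.losingMass t)
          ≤ A.η₂ * (m * A.ε) * ((n + 1) * β ^ t) := by gcongr
      linarith
  refine main.trans ?_
  have hexp : β ^ s ≤ Real.exp (-(A.rate * (A.η₁ * s))) := by
    have h1 : β ≤ Real.exp (-(A.rate * A.η₁)) := by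
      linarith [Real.add_one_le_exp (-(A.rate * A.η₁))]
    calc β ^ s ≤ Real.exp (-(A.rate * A.η₁)) ^ s := by gcongr
      _ = _ := by
        rw [← Real.exp_nat_mul]
        congr 1
        ring
  have hC' : A.η₂ / A.η₁ * (m * A.ε * (n + 1) / A.rate) = C := by
    rw [hC]
    field_simp
  rw [hC']
  gcongr
  have : 0 ≤ β ^ t := by positivity
  linarith

end Dynamics

/-! ### The limiting vector field and the comparison with its solution -/

section SoftmaxMean

variable {ι : Type*} [Fintype ι]

lemma abs_sum_softmax_mul_le [Nonempty ι] (x f : ι → ℝ) {V : ℝ} (hf : ∀ k, |f k| ≤ V) :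
    |∑ k, softmax x k * f k| ≤ V := by
  calc |∑ k, softmax x k * f k| ≤ ∑ k, |softmax x k * f k| := Finset.abs_sum_le_sum_abs _ _
    _ ≤ ∑ k, softmax x k * V := by
      refine Finset.sum_le_sum fun k _ => ?_
      rw [abs_mul, abs_of_pos (softmax_pos x k)]
      exact mul_le_mul_of_nonneg_left (hf k) (softmax_pos x k).le
    _ = V := by rw [← Finset.sum_mul, sum_softmax, one_mul]

lemma abs_sum_softmax_mul_sub_le (x y f : ι → ℝ) {V d : ℝ} (hf : ∀ k, |f k| ≤ V)
    (h : ∀ i, |x i - y i| ≤ d) :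
    |∑ k, softmax x k * f k - ∑ k, softmax y k * f k| ≤ 2 * Fintype.card ι * V * d := by
  rw [← Finset.sum_sub_distrib]
  calc _ ≤ ∑ k, |softmax x k * f k - softmax y k * f k| := Finset.abs_sum_le_sum_abs _ _
    _ ≤ ∑ _k : ι, 2 * d * V := by
      refine Finset.sum_le_sum fun k _ => ?_
      rw [← sub_mul, abs_mul]
      have h1 := abs_softmax_sub_le x y k h
      exact mul_le_mul h1 (hf k) (abs_nonneg _) ((abs_nonneg _).trans h1)
    _ = _ := by
      rw [Finset.sum_const, Finset.card_univ, nsmul_eq_mul]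
      ring

end SoftmaxMean

/-- The vector field of the limiting differential equation for the log-weights. -/
noncomputable def meanField (n m : ℕ) (ε ρ : ℝ) (z : Fin (n + 1) ⊕ Fin (m + 1) → ℝ) :
    Fin (n + 1) ⊕ Fin (m + 1) → ℝ :=
  Sum.elim
    (fun k => ∑ j, softmax (z ∘ Sum.inr) j * utility (n * ε) (bid ε k) (bid ε j))
    (fun j => ρ * ∑ k, softmax (z ∘ Sum.inl) k * utility (m * ε) (bid ε j) (bid ε k))

section MeanField

variable {n m : ℕ} {ε ρ : ℝ}

lemma abs_utility_le (hε : 0 < ε) {N M : ℕ} (k : Fin (N + 1)) (j : Fin (M + 1)) :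
    |utility (N * ε) (bid ε k) (bid ε j)| ≤ N * ε := by
  rw [abs_of_nonneg (utility_nonneg (bid_le hε k))]
  exact utility_le (by positivity) (bid_nonneg hε j)

lemma norm_meanField_le (hε : 0 < ε) (hρ : 0 < ρ) (hmn : m < n)
    (z : Fin (n + 1) ⊕ Fin (m + 1) → ℝ) : ‖meanField n m ε ρ z‖ ≤ (ρ + 1) * (n * ε) := by
  have hmn' : (m : ℝ) * ε ≤ n * ε := by gcongr
  have h0 : 0 ≤ (n : ℝ) * ε := by positivity
  refine (pi_norm_le_iff_of_nonneg (by positivity)).2 fun i => ?_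
  rw [Real.norm_eq_abs]
  rcases i with k | j
  · have := abs_sum_softmax_mul_le (z ∘ Sum.inr) _ fun j => abs_utility_le (M := m) hε k j
    simp only [meanField, Sum.elim_inl]
    nlinarith
  · have := abs_sum_softmax_mul_le (z ∘ Sum.inl) _ fun k => abs_utility_le (M := n) hε j k
    simp only [meanField, Sum.elim_inr]
    rw [abs_mul, abs_of_pos hρ]
    nlinarith

lemma norm_meanField_sub_le (hε : 0 < ε) (hρ : 0 < ρ) (hmn : m < n)
    (z z' : Fin (n + 1) ⊕ Fin (m + 1) → ℝ) :
    ‖meanField n m ε ρ z - meanField n m ε ρ z'‖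
      ≤ 2 * (n + 1) * ((ρ + 1) * (n * ε)) * ‖z - z'‖ := by
  have hmn' : (m : ℝ) * ε ≤ n * ε := by gcongr
  have hmn'' : (m : ℝ) ≤ n := by exact_mod_cast hmn.le
  have h0 : 0 ≤ (n : ℝ) * ε := by positivity
  refine (pi_norm_le_iff_of_nonneg (by positivity)).2 fun i => ?_
  rw [Real.norm_eq_abs, Pi.sub_apply]
  rcases i with k | j
  · have := abs_sum_softmax_mul_sub_le (z ∘ Sum.inr) (z' ∘ Sum.inr) _
      (fun j => abs_utility_le (M := m) hε k j) (fun j => norm_le_pi_norm (z - z') (Sum.inr j))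
    simp only [meanField, Sum.elim_inl]
    have h1 : (n : ℝ) * ε ≤ (ρ + 1) * (n * ε) := by nlinarith
    rw [Fintype.card_fin] at this
    push_cast at this
    calc _ ≤ 2 * ((m : ℝ) + 1) * (n * ε) * ‖z - z'‖ := this
      _ ≤ 2 * ((n : ℝ) + 1) * (n * ε) * ‖z - z'‖ := by gcongr
      _ ≤ _ := mul_le_mul_of_nonneg_right
        (mul_le_mul_of_nonneg_left h1 (by positivity)) (norm_nonneg _)
  · have := abs_sum_softmax_mul_sub_le (z ∘ Sum.inl) (z' ∘ Sum.inl) _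
      (fun k => abs_utility_le (M := n) hε j k) (fun k => norm_le_pi_norm (z - z') (Sum.inl k))
    simp only [meanField, Sum.elim_inr]
    rw [← mul_sub, abs_mul, abs_of_pos hρ]
    calc _ ≤ ρ * (2 * (Fintype.card (Fin (n + 1))) * (m * ε) * ‖z - z'‖) := by gcongr
      _ ≤ (ρ + 1) * (2 * (n + 1) * (n * ε) * ‖z - z'‖) := by
        rw [Fintype.card_fin]
        push_cast
        gcongr
        linarith
      _ = _ := by ring

end MeanField

namespace Dynamics

variable {n m : ℕ} (A : Dynamics n m) {T : ℕ}

/-- The distance between the expected increments of the log-weights, divided by `η₁`, and the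
limiting vector field. -/
noncomputable def driftError (ρ : ℝ) : ℝ :=
  A.η₁ * ((ρ + 1) * (n * A.ε)) ^ 2 + |A.η₂ / A.η₁ - ρ| * (n * A.ε)

lemma abs_highGain_le (k : Fin (n + 1)) (j : Fin (m + 1)) : |A.highGain k j| ≤ A.η₁ * (n * A.ε) := by
  rw [abs_of_nonneg (A.highGain_nonneg k j)]
  exact A.highGain_le k j

lemma abs_lowGain_le (j : Fin (m + 1)) (k : Fin (n + 1)) : |A.lowGain j k| ≤ A.η₂ * (m * A.ε) := by
  rw [abs_of_nonneg (A.lowGain_nonneg j k)]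
  exact A.lowGain_le j k

/-- The comparison is made for the log-weights of both players jointly, since the drift of each
depends on the other's; afterwards a single low coordinate is kept. -/
lemma mean_sq_lowWeight_sub_le (hmn : m < n) {ρ : ℝ} (hρ : 0 < ρ) (hη : A.η₂ / A.η₁ ≤ ρ + 1)
    {S : ℝ} {ζ : ℝ → Fin (n + 1) ⊕ Fin (m + 1) → ℝ} (hζ0 : ζ 0 = 0)
    (hζ : ∀ s ∈ Set.Icc 0 S,
      HasDerivWithinAt ζ (meanField n m A.ε ρ (ζ s)) (Set.Icc 0 S) s)
    {t : ℕ} (ht : t ≤ T) (htS : A.η₁ * t ≤ S) (j : Fin (m + 1)) {B L : ℝ}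
    (hB : B = (ρ + 1) * (n * A.ε)) (hL : L = 2 * (n + 1) * B) :
    mean (A.P T) (fun ω => (A.lowWeight t ω j - ζ (A.η₁ * t) (Sum.inr j)) ^ 2)
      ≤ Fintype.card (Fin (n + 1) ⊕ Fin (m + 1))
        * ((A.driftError ρ + L * B * A.η₁) ^ 2 + 4 * B ^ 2 * A.η₁) * S
        * Real.exp ((2 * L * Fintype.card (Fin (n + 1) ⊕ Fin (m + 1)) + 1) * S) := by
  have hη1 := A.η₁_pos
  have hη2 := A.η₂_pos
  have hε := A.ε_pos
  have hmn' : (m : ℝ) ≤ n := by exact_mod_cast hmn.le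
  have hV : (m : ℝ) * A.ε ≤ n * A.ε := by gcongr
  have hV0 : 0 ≤ (n : ℝ) * A.ε := by positivity
  have hη' : A.η₂ ≤ (ρ + 1) * A.η₁ := (div_le_iff₀ hη1).1 hη
  have hB0 : 0 ≤ B := by rw [hB]; positivity
  have hL0 : 0 ≤ L := by rw [hL]; positivity
  have hgain2 : A.η₂ * (m * A.ε) ≤ B * A.η₁ := by
    rw [hB]
    calc A.η₂ * (m * A.ε) ≤ ((ρ + 1) * A.η₁) * (n * A.ε) := by gcongr
      _ = _ := by ring
  refine le_trans ?_ (A.isKernel.mean_sq_sub_solution_le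
    (fun t ω => Sum.elim (A.highWeight t ω) (A.lowWeight t ω))
    (fun _ _ r => Sum.elim (fun k => A.highGain k r.1.2) (fun j => A.lowGain j r.1.1))
    (F := meanField n m A.ε ρ) (B := B) (L := L) (S := S) (η := A.η₁) (θ := A.driftError ρ) (ζ := ζ)
    (fun z => by rw [hB]; exact norm_meanField_le hε hρ hmn z) hL0
    (fun z z' => by rw [hL, hB]; exact norm_meanField_sub_le hε hρ hmn z z')
    hζ0 hζ ?_ ?_ ?_ ?_ hη1 ?_ ?_ ht htS)
  · refine mean_mono A.P_nonneg fun ω => ?_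
    exact Finset.single_le_sum
      (f := fun i => (Sum.elim (A.highWeight t ω) (A.lowWeight t ω) i - ζ (A.η₁ * t) i) ^ 2)
      (fun i _ => sq_nonneg _) (Finset.mem_univ (Sum.inr j))
  · intro ω
    rw [A.highWeight_zero, A.lowWeight_zero]
    ext (i | i) <;> rfl
  · rintro t ω (k | j)
    · exact A.highWeight_succ t ω k
    · exact A.lowWeight_succ t ω j
  · intro t ω ω' h
    dsimp only
    rw [A.highWeight_predictable t _ _ h, A.lowWeight_predictable t _ _ h]
  · intro t ω ω' h
    rfl
  · rintro t ω r (k | j)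
    · refine (A.abs_highGain_le k r.1.2).trans ?_
      rw [hB]
      nlinarith [mul_nonneg hη1.le hV0]
    · exact (A.abs_lowGain_le j r.1.1).trans hgain2
  · rintro t ω (k | j)
    · simp only [meanField, Sum.elim_inl, Sum.elim_comp_inr]
      rw [A.sum_kernel_low t ω fun j => A.highGain k j, Finset.mul_sum, ← Finset.sum_sub_distrib]
      have := abs_sum_softmax_mul_le (A.lowWeight t ω)
        (fun j => A.highGain k j - A.η₁ * utility (n * A.ε) (bid A.ε k) (bid A.ε j))
        (V := (A.η₁ * (n * A.ε)) ^ 2) fun j =>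
          abs_logFactor_sub_le hη1.le (utility_nonneg (bid_le hε k))
            (utility_le hV0 (bid_nonneg hε j))
      calc _ = |∑ j, softmax (A.lowWeight t ω) j
            * (A.highGain k j - A.η₁ * utility (n * A.ε) (bid A.ε k) (bid A.ε j))| := by
            congr 1
            exact Finset.sum_congr rfl fun j _ => by ring
        _ ≤ (A.η₁ * (n * A.ε)) ^ 2 := this
        -- Written in the shape of `driftError`, so that the terms compare one by one. The high
        -- player's drift has no ratio error, as time is measured in units of `η₁`.
        _ = A.η₁ * (A.η₁ * (1 * (n * A.ε)) ^ 2 + 0 * (n * A.ε)) := by ring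
        _ ≤ _ := by
            unfold driftError
            gcongr
            · linarith
            · exact abs_nonneg _
    · simp only [meanField, Sum.elim_inr, Sum.elim_comp_inl]
      rw [A.sum_kernel_high t ω fun k => A.lowGain j k, ← mul_assoc, Finset.mul_sum,
        ← Finset.sum_sub_distrib]
      have := abs_sum_softmax_mul_le (A.highWeight t ω)
        (fun k => A.lowGain j k - A.η₁ * ρ * utility (m * A.ε) (bid A.ε j) (bid A.ε k))
        (V := A.η₁ * A.driftError ρ) fun k => by
          have h1 := abs_logFactor_sub_le (rule := A.rule₂) hη2.le
            (utility_nonneg (c := bid A.ε k) (bid_le hε j))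
            (utility_le (A.value_nonneg m) (bid_nonneg hε k))
          have h2 := abs_utility_le hε j k
          set u := utility (m * A.ε) (bid A.ε j) (bid A.ε k) with hu
          have h3 : A.η₂ * u - A.η₁ * ρ * u = A.η₁ * ((A.η₂ / A.η₁ - ρ) * u) := by
            field_simp
          calc |A.lowGain j k - A.η₁ * ρ * u|
              = |(A.rule₂.logFactor A.η₂ u - A.η₂ * u) + (A.η₂ * u - A.η₁ * ρ * u)| := by
                congr 1
                simp only [lowGain, hu]
                ring
            _ ≤ (A.η₂ * (m * A.ε)) ^ 2 + A.η₁ * (|A.η₂ / A.η₁ - ρ| * (n * A.ε)) := by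
                refine (abs_add_le _ _).trans (add_le_add h1 ?_)
                rw [h3, abs_mul, abs_of_pos hη1, abs_mul]
                gcongr
                exact h2.trans hV
            _ ≤ (B * A.η₁) ^ 2 + A.η₁ * (|A.η₂ / A.η₁ - ρ| * (n * A.ε)) := by gcongr
            _ = A.η₁ * A.driftError ρ := by
                rw [driftError, hB]
                ring
      refine le_trans (le_of_eq ?_) this
      congr 1
      exact Finset.sum_congr rfl fun k _ => by ring

lemma mean_abs_le_sqrt (f : History n m T → ℝ) :
    mean (A.P T) (fun ω => |f ω|) ≤ Real.sqrt (mean (A.P T) (fun ω => f ω ^ 2)) := by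
  refine Real.le_sqrt_of_sq_le ?_
  have := mean_sq_le A.P_nonneg A.sum_P fun ω => |f ω|
  simpa only [sq_abs] using this

end Dynamics

/-! ### Deterministic limits of the low player's log-weights -/

/-- Dynamics for each horizon, with update parameters in the regime of the limit theorem. -/
structure IsLimitRegime {n m : ℕ} (A : ℕ → Dynamics n m) (ε ρ : ℝ) : Prop where
  lt : m < n
  ratio_pos : 0 < ρ
  bid_unit : ∀ T, (A T).ε = ε
  tendsto_zero : Tendsto (fun T => (A T).η₁) atTop (𝓝 0)
  tendsto_atTop : Tendsto (fun T : ℕ => (T : ℝ) * (A T).η₁) atTop atTop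
  tendsto_ratio : Tendsto (fun T => (A T).η₂ / (A T).η₁) atTop (𝓝 ρ)

namespace IsLimitRegime

variable {n m : ℕ} {A : ℕ → Dynamics n m} {ε ρ : ℝ}

/-- The round that corresponds to time `S` of the limiting differential equation. -/
noncomputable def _root_.MWAuction.Dynamics.roundAt {n m : ℕ} (A : Dynamics n m) (S : ℝ) : ℕ :=
  ⌊S / A.η₁⌋₊

lemma mul_roundAt_le (A : Dynamics n m) {S : ℝ} (hS : 0 ≤ S) : A.η₁ * A.roundAt S ≤ S := by
  have h := A.η₁_pos
  have := Nat.floor_le (div_nonneg hS h.le)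
  rwa [le_div_iff₀ h, mul_comm] at this

lemma sub_le_mul_roundAt (A : Dynamics n m) (S : ℝ) : S - A.η₁ ≤ A.η₁ * A.roundAt S := by
  have h := A.η₁_pos
  have := Nat.lt_floor_add_one (S / A.η₁)
  rw [div_lt_iff₀ h] at this
  have e : A.roundAt S = ⌊S / A.η₁⌋₊ := rfl
  rw [e]
  linarith

lemma roundAt_mono (A : Dynamics n m) {S S' : ℝ} (h : S ≤ S') : A.roundAt S ≤ A.roundAt S' :=
  Nat.floor_le_floor (div_le_div_of_nonneg_right h A.η₁_pos.le)

lemma eventually_roundAt_le (h : IsLimitRegime A ε ρ) {S : ℝ} (hS : 0 ≤ S) {δ : ℝ} (hδ : 0 < δ) :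
    ∀ᶠ T in atTop, ((A T).roundAt S : ℝ) ≤ δ * T := by
  filter_upwards [h.tendsto_atTop.eventually_ge_atTop (S / δ)] with T hT
  have h1 := mul_roundAt_le (A T) hS
  have h2 := (A T).η₁_pos
  rw [div_le_iff₀ hδ] at hT
  have : (A T).η₁ * ((A T).roundAt S) ≤ (A T).η₁ * (δ * T) := by linarith
  exact le_of_mul_le_mul_left this h2

lemma eventually_roundAt_le_self (h : IsLimitRegime A ε ρ) {S : ℝ} (hS : 0 ≤ S) :
    ∀ᶠ T in atTop, (A T).roundAt S ≤ T := by
  filter_upwards [h.eventually_roundAt_le hS one_pos] with T hT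
  rw [one_mul] at hT
  exact_mod_cast hT

lemma eventually_small (h : IsLimitRegime A ε ρ) :
    ∀ᶠ T in atTop, (A T).η₁ * ((n - m) * (A T).ε) ≤ 1 / 4 := by
  have h1 := h.tendsto_zero.mul_const (((n : ℝ) - m) * ε)
  rw [zero_mul] at h1
  filter_upwards [h1.eventually_le_const (show (0 : ℝ) < 1 / 4 by norm_num)] with T hT
  rwa [h.bid_unit]

lemma eventually_ratio_le (h : IsLimitRegime A ε ρ) :
    ∀ᶠ T in atTop, (A T).η₂ / (A T).η₁ ≤ ρ + 1 :=
  h.tendsto_ratio.eventually_le_const (by linarith)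

/-- At time `S` of the differential equation, the low player's log-weights are close to its
solution. -/
lemma exists_tendsto_lowWeight (h : IsLimitRegime A ε ρ) {S : ℝ} (hS : 0 ≤ S) :
    ∃ y : Fin (m + 1) → ℝ, ∀ j, Tendsto (fun T => mean ((A T).P T)
      (fun ω => |(A T).lowWeight ((A T).roundAt S) ω j - y j|)) atTop (𝓝 0) := by
  have hε : 0 < ε := h.bid_unit 0 ▸ (A 0).ε_pos
  obtain ⟨B, hB⟩ : ∃ B, B = (ρ + 1) * (n * ε) := ⟨_, rfl⟩
  obtain ⟨L, hL⟩ : ∃ L, L = 2 * (n + 1) * B := ⟨_, rfl⟩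
  have hρ := h.ratio_pos
  have hB0 : 0 ≤ B := by rw [hB]; positivity
  have hL0 : 0 ≤ L := by rw [hL]; positivity
  have hFB : ∀ z, ‖meanField n m ε ρ z‖ ≤ B := fun z => by
    rw [hB]
    exact norm_meanField_le hε hρ h.lt z
  obtain ⟨ζ, hζ0, hζ⟩ := exists_solution (meanField n m ε ρ) hFB hL0
    (fun z z' => by rw [hL, hB]; exact norm_meanField_sub_le hε hρ h.lt z z') hS
  refine ⟨fun j => ζ S (Sum.inr j), fun j => ?_⟩
  set N : ℝ := (Fintype.card (Fin (n + 1) ⊕ Fin (m + 1)) : ℝ)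
  have herr : Tendsto (fun T => (A T).driftError ρ) atTop (𝓝 0) := by
    have h1 := h.tendsto_zero.mul_const (((ρ + 1) * (n * ε)) ^ 2)
    have h2 := ((h.tendsto_ratio.sub_const ρ).abs).mul_const ((n : ℝ) * ε)
    have h3 := h1.add h2
    simp only [sub_self, abs_zero, zero_mul, add_zero] at h3
    refine h3.congr fun T => ?_
    rw [Dynamics.driftError, h.bid_unit]
  have hbound : Tendsto (fun T => Real.sqrt (N
      * (((A T).driftError ρ + L * B * (A T).η₁) ^ 2 + 4 * B ^ 2 * (A T).η₁) * S
      * Real.exp ((2 * L * N + 1) * S)) + B * (A T).η₁) atTop (𝓝 0) := by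
    have h1 := (herr.add (h.tendsto_zero.const_mul (L * B))).pow 2
    have h2 := h1.add (h.tendsto_zero.const_mul (4 * B ^ 2))
    have h3 := (((h2.const_mul N).mul_const S).mul_const (Real.exp ((2 * L * N + 1) * S))).sqrt
    have h4 := h3.add (h.tendsto_zero.const_mul B)
    simpa using h4
  refine squeeze_zero' (Eventually.of_forall fun T =>
    mean_nonneg (A T).P_nonneg fun ω => abs_nonneg _) ?_ hbound
  filter_upwards [h.eventually_roundAt_le_self hS, h.eventually_ratio_le] with T hT hr
  have h1 := (A T).mean_sq_lowWeight_sub_le h.lt hρ hr hζ0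
    (by rw [h.bid_unit]; exact hζ) hT (mul_roundAt_le (A T) hS) j (B := B) (L := L)
    (by rw [h.bid_unit]; exact hB) hL
  have h2 := (A T).mean_abs_le_sqrt (T := T)
    (fun ω => (A T).lowWeight ((A T).roundAt S) ω j
      - ζ ((A T).η₁ * (A T).roundAt S) (Sum.inr j))
  have hη := (A T).η₁_pos
  -- Rounding `S / η₁` down to a whole round loses at most `η₁` of time, and the solution has speed
  -- at most `B`.
  have h3 : |ζ S (Sum.inr j) - ζ ((A T).η₁ * (A T).roundAt S) (Sum.inr j)| ≤ B * (A T).η₁ := by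
    refine (norm_le_pi_norm (ζ S - ζ ((A T).η₁ * (A T).roundAt S)) (Sum.inr j)).trans ?_
    refine (norm_solution_sub_le hFB hζ (by positivity) (mul_roundAt_le (A T) hS) le_rfl).trans ?_
    have := sub_le_mul_roundAt (A T) S
    gcongr
    linarith
  calc mean ((A T).P T) (fun ω => |(A T).lowWeight ((A T).roundAt S) ω j - ζ S (Sum.inr j)|)
      ≤ mean ((A T).P T) (fun ω => |(A T).lowWeight ((A T).roundAt S) ω j
          - ζ ((A T).η₁ * (A T).roundAt S) (Sum.inr j)| + B * (A T).η₁) := by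
        refine mean_mono (A T).P_nonneg fun ω => ?_
        refine (abs_sub_le _ (ζ ((A T).η₁ * (A T).roundAt S) (Sum.inr j)) _).trans ?_
        rw [abs_sub_comm (ζ _ _) (ζ S _)]
        gcongr
    _ ≤ _ := by
        rw [mean_add, mean_const (A T).sum_P]
        gcongr
        exact h2.trans (Real.sqrt_le_sqrt h1)

/-- The limits of the low player's log-weights at time `N` of the differential equation. -/
noncomputable def lowLimitAt (h : IsLimitRegime A ε ρ) (N : ℕ) : Fin (m + 1) → ℝ :=
  (h.exists_tendsto_lowWeight N.cast_nonneg).choose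

lemma tendsto_lowLimitAt (h : IsLimitRegime A ε ρ) (N : ℕ) (j : Fin (m + 1)) :
    Tendsto (fun T => mean ((A T).P T)
      (fun ω => |(A T).lowWeight ((A T).roundAt N) ω j - h.lowLimitAt N j|)) atTop (𝓝 0) :=
  (h.exists_tendsto_lowWeight N.cast_nonneg).choose_spec j

/-- A pathwise inequality passes to the deterministic limits by taking means; the same device gives
`abs_lowLimitAt_sub_le`. -/
lemma lowLimitAt_mono (h : IsLimitRegime A ε ρ) (N : ℕ) : Monotone (h.lowLimitAt N) := by
  intro j j' hj
  have h1 := (h.tendsto_lowLimitAt N j).add (h.tendsto_lowLimitAt N j')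
  rw [add_zero] at h1
  refine sub_nonpos.1 (ge_of_tendsto' h1 fun T => ?_)
  rw [← mean_add, ← mean_const (A T).sum_P (h.lowLimitAt N j - h.lowLimitAt N j')]
  refine mean_mono (A T).P_nonneg fun ω => ?_
  have h2 := (A T).lowWeight_mono ((A T).roundAt N) ω hj
  linarith [neg_abs_le ((A T).lowWeight ((A T).roundAt N) ω j - h.lowLimitAt N j),
    le_abs_self ((A T).lowWeight ((A T).roundAt N) ω j' - h.lowLimitAt N j')]

/-- A bound for the growth of the low player's log-weights after time `N`. -/
noncomputable def tailBound (_h : IsLimitRegime A ε ρ) (N : ℕ) : ℝ :=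
  (ρ + 1) * (m * ε * (n + 1) / (A 0).rate) * Real.exp (-((A 0).rate * (N - 1)))

lemma rate_eq (h : IsLimitRegime A ε ρ) (T : ℕ) : (A T).rate = (A 0).rate := by
  rw [Dynamics.rate, Dynamics.rate, h.bid_unit, h.bid_unit]

lemma eventually_sub_one_le (h : IsLimitRegime A ε ρ) :
    ∀ᶠ T in atTop, ∀ N : ℕ, (N : ℝ) - 1 ≤ (A T).η₁ * (A T).roundAt N := by
  filter_upwards [h.tendsto_zero.eventually_le_const one_pos] with T hT N
  linarith [sub_le_mul_roundAt (A T) N]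

lemma eventually_mean_lowWeight_sub_le (h : IsLimitRegime A ε ρ) :
    ∀ᶠ T in atTop, ∀ (N t : ℕ), (A T).roundAt N ≤ t → t ≤ T → ∀ j,
      mean ((A T).P T) (fun ω => (A T).lowWeight t ω j - (A T).lowWeight ((A T).roundAt N) ω j)
        ≤ h.tailBound N := by
  have hρ := h.ratio_pos
  have hε : 0 < ε := h.bid_unit 0 ▸ (A 0).ε_pos
  have hr := (A 0).rate_pos h.lt
  filter_upwards [h.eventually_small, h.eventually_ratio_le, h.eventually_sub_one_le]
    with T h1 h2 h3 N t hNt htT j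
  refine ((A T).mean_lowWeight_sub_le h.lt h1 hNt htT j).trans ?_
  rw [h.rate_eq, h.bid_unit, tailBound]
  gcongr
  exact h3 N

lemma tendsto_exp_rate (h : IsLimitRegime A ε ρ) :
    Tendsto (fun N : ℕ => Real.exp (-((A 0).rate * ((N : ℝ) - 1)))) atTop (𝓝 0) := by
  refine Real.tendsto_exp_neg_atTop_nhds_zero.comp ?_
  exact (tendsto_atTop_add_const_right _ _ tendsto_natCast_atTop_atTop).const_mul_atTop
    ((A 0).rate_pos h.lt)

lemma tendsto_tailBound (h : IsLimitRegime A ε ρ) : Tendsto h.tailBound atTop (𝓝 0) := by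
  have := h.tendsto_exp_rate.const_mul ((ρ + 1) * (m * ε * (n + 1) / (A 0).rate))
  rwa [mul_zero] at this

/-- The tail bound on the random process becomes a Cauchy estimate for the solution's values, so no
analysis of the differential equation at large times is needed. -/
lemma abs_lowLimitAt_sub_le (h : IsLimitRegime A ε ρ) {N M : ℕ} (hNM : N ≤ M) (j : Fin (m + 1)) :
    |h.lowLimitAt M j - h.lowLimitAt N j| ≤ h.tailBound N := by
  have h1 := ((h.tendsto_lowLimitAt M j).add (h.tendsto_lowLimitAt N j)).add_const (h.tailBound N)
  rw [add_zero, zero_add] at h1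
  refine ge_of_tendsto h1 ?_
  filter_upwards [h.eventually_mean_lowWeight_sub_le, h.eventually_roundAt_le_self M.cast_nonneg]
    with T h2 h3
  have hr : (A T).roundAt N ≤ (A T).roundAt M := roundAt_mono _ (by exact_mod_cast hNM)
  refine le_trans ?_ (add_le_add_right (h2 N _ hr h3 j) _)
  rw [← mean_add, ← mean_add, ← mean_const (A T).sum_P |h.lowLimitAt M j - h.lowLimitAt N j|]
  refine mean_mono (A T).P_nonneg fun ω => ?_
  have h4 := (A T).lowWeight_mono_time hr ω j
  have h5 := abs_le.1 (le_refl |(A T).lowWeight ((A T).roundAt N) ω j - h.lowLimitAt N j|)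
  have h6 := abs_le.1 (le_refl |(A T).lowWeight ((A T).roundAt M) ω j - h.lowLimitAt M j|)
  rw [abs_le]
  constructor <;> linarith

lemma exists_tendsto_lowLimitAt (h : IsLimitRegime A ε ρ) (j : Fin (m + 1)) :
    ∃ y, Tendsto (fun N => h.lowLimitAt N j) atTop (𝓝 y) := by
  have h1 := h.tendsto_tailBound.const_mul 2
  rw [mul_zero] at h1
  refine cauchySeq_tendsto_of_complete (cauchySeq_of_le_tendsto_0 _ (fun k l N hk hl => ?_) h1)
  refine (dist_triangle_right _ _ (h.lowLimitAt N j)).trans ?_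
  rw [Real.dist_eq, Real.dist_eq]
  linarith [h.abs_lowLimitAt_sub_le hk j, h.abs_lowLimitAt_sub_le hl j]

/-- The limits of the low player's log-weights. -/
noncomputable def lowLimit (h : IsLimitRegime A ε ρ) (j : Fin (m + 1)) : ℝ :=
  (h.exists_tendsto_lowLimitAt j).choose

lemma tendsto_lowLimit (h : IsLimitRegime A ε ρ) (j : Fin (m + 1)) :
    Tendsto (fun N => h.lowLimitAt N j) atTop (𝓝 (h.lowLimit j)) :=
  (h.exists_tendsto_lowLimitAt j).choose_spec

lemma lowLimit_mono (h : IsLimitRegime A ε ρ) : Monotone h.lowLimit := fun j j' hj =>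
  le_of_tendsto_of_tendsto' (h.tendsto_lowLimit j) (h.tendsto_lowLimit j')
    fun N => h.lowLimitAt_mono N hj

lemma abs_lowLimit_sub_le (h : IsLimitRegime A ε ρ) (N : ℕ) (j : Fin (m + 1)) :
    |h.lowLimit j - h.lowLimitAt N j| ≤ h.tailBound N :=
  le_of_tendsto ((h.tendsto_lowLimit j).sub_const _).abs
    ((eventually_ge_atTop N).mono fun _ hM => h.abs_lowLimitAt_sub_le hM j)

/-- From some time of the differential equation on, the low player's log-weights are close to
their limits and the high player's losing bids have little weight. -/
lemma exists_eventually_close (h : IsLimitRegime A ε ρ) {δ : ℝ} (hδ : 0 < δ) :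
    ∃ N : ℕ, ∀ᶠ T in atTop, ∀ t, (A T).roundAt N ≤ t → t ≤ T →
      (∀ j, mean ((A T).P T) (fun ω => |(A T).lowWeight t ω j - h.lowLimit j|) ≤ δ) ∧
      mean ((A T).P T) ((A T).losingMass t) ≤ δ := by
  have h1 := h.tendsto_exp_rate.const_mul ((n : ℝ) + 1)
  rw [mul_zero] at h1
  -- `N` is fixed before `T`: the comparison with the differential equation is only needed at the
  -- single time `N`, and monotonicity in time with the tail bound covers all later rounds.
  obtain ⟨N, hN1, hN2⟩ := ((h.tendsto_tailBound.eventually_le_const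
    (show 0 < δ / 3 by positivity)).and (h1.eventually_le_const hδ)).exists
  refine ⟨N, ?_⟩
  have h2 : ∀ᶠ T in atTop, ∀ j, mean ((A T).P T)
      (fun ω => |(A T).lowWeight ((A T).roundAt N) ω j - h.lowLimitAt N j|) ≤ δ / 3 :=
    eventually_all.2 fun j => (h.tendsto_lowLimitAt N j).eventually_le_const (by positivity)
  filter_upwards [h2, h.eventually_mean_lowWeight_sub_le, h.eventually_small,
    h.eventually_sub_one_le] with T h3 h4 h5 h6 t ht htT
  refine ⟨fun j => ?_, ?_⟩
  · calc mean ((A T).P T) (fun ω => |(A T).lowWeight t ω j - h.lowLimit j|)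
        ≤ mean ((A T).P T) (fun ω =>
          (((A T).lowWeight t ω j - (A T).lowWeight ((A T).roundAt N) ω j)
          + |(A T).lowWeight ((A T).roundAt N) ω j - h.lowLimitAt N j|) + δ / 3) := by
          refine mean_mono (A T).P_nonneg fun ω => ?_
          have a1 := (A T).lowWeight_mono_time ht ω j
          have a2 := abs_le.1 (h.abs_lowLimit_sub_le N j)
          have a3 := abs_le.1 (le_refl
            |(A T).lowWeight ((A T).roundAt N) ω j - h.lowLimitAt N j|)
          rw [abs_le]
          constructor <;> linarith
      _ ≤ δ := by
          rw [mean_add, mean_add, mean_const (A T).sum_P]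
          linarith [h3 j, h4 N t ht htT j]
  · refine ((A T).mean_losingMass_le h.lt h5 htT).trans (le_trans ?_ hN2)
    have hη := (A T).η₁_pos
    have hr := (A 0).rate_pos h.lt
    have b0 := (A T).rate_mul_le_one h5
    rw [h.rate_eq] at b0 ⊢
    have b1 : 1 - (A 0).rate * (A T).η₁ ≤ Real.exp (-((A 0).rate * (A T).η₁)) := by
      linarith [Real.add_one_le_exp (-((A 0).rate * (A T).η₁))]
    have b2 : (N : ℝ) - 1 ≤ (A T).η₁ * t := (h6 N).trans (by gcongr)
    gcongr
    calc (1 - (A 0).rate * (A T).η₁) ^ t ≤ Real.exp (-((A 0).rate * (A T).η₁)) ^ t := by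
          gcongr
      _ = Real.exp (-((A 0).rate * ((A T).η₁ * t))) := by
          rw [← Real.exp_nat_mul]
          congr 1
          ring
      _ ≤ _ := by gcongr

end IsLimitRegime

/-! ### Martingale part of the counts -/

namespace Dynamics

variable {n m : ℕ} (A : Dynamics n m) {T : ℕ}

/-- The conditional probability of the pair of bids `b` after `t` rounds. -/
noncomputable def pairProb (t : ℕ) (ω : History n m T) (b : Fin (n + 1) × Fin (m + 1)) : ℝ :=
  softmax (A.highWeight t ω) b.1 * softmax (A.lowWeight t ω) b.2

lemma pairProb_mem (t : ℕ) (ω : History n m T) (b : Fin (n + 1) × Fin (m + 1)) :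
    A.pairProb t ω b ∈ Set.Icc (0 : ℝ) 1 :=
  ⟨mul_nonneg (softmax_pos _ _).le (softmax_pos _ _).le,
    mul_le_one₀ (softmax_le_one _ _) (softmax_pos _ _).le (softmax_le_one _ _)⟩

/-- The martingale part of the number of occurrences of the pair of bids `b`. -/
noncomputable def deviation (b : Fin (n + 1) × Fin (m + 1)) (t : ℕ) (ω : History n m T) : ℝ :=
  ∑ s ∈ Finset.univ.filter (fun s : Fin T => (s : ℕ) < t),
    ((if (ω s).1 = b then 1 else 0) - A.pairProb s ω b)

/-- Kolmogorov's inequality for increments of the form indicator minus conditional probability,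
which lie in `[-1, 1]` and so have conditional variance at most one. -/
lemma prob_deviation_le (b : Fin (n + 1) × Fin (m + 1)) {c : ℝ} (hc : 0 < c) :
    c ^ 2 * prob (A.P T) {ω | ∃ s ≤ T, c ≤ |A.deviation b s ω|} ≤ T := by
  have hpred : ∀ t : ℕ, Predictable t (fun ω : History n m T => A.pairProb t ω b) :=
    fun t ω ω' h => by
      simp only [pairProb, A.highWeight_predictable t _ _ h, A.lowWeight_predictable t _ _ h]
  rw [← one_mul (T : ℝ)]
  refine A.isKernel.maximal_inequality (A.deviation b)
    (fun t ω r => (if r.1 = b then 1 else 0) - A.pairProb t ω b) ?_ ?_ ?_ ?_ ?_ zero_le_one ?_ hc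
  · intro ω
    simp [deviation]
  · intro t ω
    have h : (Finset.univ.filter fun s : Fin T => (s : ℕ) < t + 1)
        = insert t (Finset.univ.filter fun s : Fin T => (s : ℕ) < t) := by
      ext s
      simp only [Finset.mem_filter_univ, Finset.mem_insert, Fin.ext_iff]
      omega
    rw [deviation, h, Finset.sum_insert (by simp), add_comm]
    rfl
  · intro t ω ω' h
    refine Finset.sum_congr rfl fun s hs => ?_
    have hs := (Finset.mem_filter.1 hs).2
    have e : A.pairProb s ω b = A.pairProb s ω' b := (hpred s).mono hs.le _ _ h
    rw [h s hs, e]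
  · intro t ω ω' h
    ext r
    have e : A.pairProb t ω b = A.pairProb t ω' b := hpred t _ _ h
    dsimp only
    rw [e]
  · intro t ω
    simp only [mul_sub, Finset.sum_sub_distrib, ← Finset.sum_mul, A.isKernel.sum_eq_one, one_mul]
    rw [A.sum_kernel_mul t ω fun b' => if b' = b then 1 else 0, ← Fintype.sum_prod_type'
      (f := fun k j => softmax (A.highWeight t ω) k * softmax (A.lowWeight t ω) j
        * if (k, j) = b then 1 else 0)]
    simp [pairProb]
  · intro t ω
    refine le_of_le_of_eq ?_ (A.isKernel.sum_eq_one t ω)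
    refine Finset.sum_le_sum fun r _ => mul_le_of_le_one_right (A.isKernel.nonneg t ω r) ?_
    have := A.pairProb_mem t ω b
    rw [sq_le_one_iff_abs_le_one, abs_le]
    split_ifs <;> constructor <;> linarith [this.1, this.2]

end Dynamics

/-! ### The high player's uniform limit -/

lemma card_filter_lt {n m : ℕ} (hmn : m < n) :
    ((Finset.univ.filter fun k : Fin (n + 1) => m < (k : ℕ)).card : ℝ) = n - m := by
  have h : (Finset.univ.filter fun k : Fin (n + 1) => m < (k : ℕ))
      = Finset.Ioi (⟨m, by omega⟩ : Fin (n + 1)) := by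
    ext k
    simp [Fin.lt_def]
  rw [h, Fin.card_Ioi]
  simp only [Nat.add_sub_cancel]
  exact Nat.cast_sub hmn.le

/-- The uniform distribution on the bids above `m`. -/
noncomputable def highLimit (n m : ℕ) (k : Fin (n + 1)) : ℝ :=
  if m < (k : ℕ) then 1 / ((n : ℝ) - m) else 0

lemma highLimit_nonneg {n m : ℕ} (hmn : m < n) (k : Fin (n + 1)) : 0 ≤ highLimit n m k := by
  have : (m : ℝ) < n := by exact_mod_cast hmn
  unfold highLimit
  split_ifs
  · exact div_nonneg zero_le_one (by linarith)
  · exact le_rfl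

lemma sum_highLimit {n m : ℕ} (hmn : m < n) : ∑ k, highLimit n m k = 1 := by
  have : (m : ℝ) < n := by exact_mod_cast hmn
  simp only [highLimit]
  rw [← Finset.sum_filter, Finset.sum_const, nsmul_eq_mul, card_filter_lt hmn]
  field_simp
  exact div_self (by linarith)

lemma highLimit_le_one {n m : ℕ} (hmn : m < n) (k : Fin (n + 1)) : highLimit n m k ≤ 1 := by
  rw [← sum_highLimit hmn]
  exact Finset.single_le_sum (f := highLimit n m) (fun i _ => highLimit_nonneg hmn i)
    (Finset.mem_univ k)

/-- If the bids up to `m` have total probability `l`, each of the `n - m` equally likely higher bids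
has exactly `(1 - l) / (n - m)`, an error of `l / (n - m) ≤ l`. -/
lemma Dynamics.abs_softmax_highWeight_sub_le {n m T : ℕ} (A : Dynamics n m) (hmn : m < n) (t : ℕ)
    (ω : History n m T) (k : Fin (n + 1)) :
    |softmax (A.highWeight t ω) k - highLimit n m k| ≤ A.losingMass t ω := by
  set σ := softmax (A.highWeight t ω) with hσ
  have hpos : ∀ k, 0 < σ k := softmax_pos _
  have h1 : ∑ k ∈ Finset.univ.filter (fun k : Fin (n + 1) => (k : ℕ) ≤ m), σ k
      ≤ A.losingMass t ω :=
    Finset.sum_le_sum fun k _ => softmax_le_exp_sub _ k (Fin.last n)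
  by_cases hk : m < (k : ℕ)
  · rw [highLimit, if_pos hk]
    have hmn1 : (1 : ℝ) ≤ n - m := by
      have : (m : ℝ) + 1 ≤ n := by exact_mod_cast hmn
      linarith
    have h2 : ∑ k' ∈ Finset.univ.filter (fun k : Fin (n + 1) => ¬ (k : ℕ) ≤ m), σ k'
        = (n - m) * σ k := by
      rw [← card_filter_lt hmn, ← nsmul_eq_mul, ← Finset.sum_const]
      simp only [not_le]
      refine Finset.sum_congr rfl fun l hl => ?_
      have h := A.highWeight_eq (Finset.mem_filter.1 hl).2 hk t ω
      exact le_antisymm (softmax_le_softmax _ h.le) (softmax_le_softmax _ h.ge)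
    have h3 := Finset.sum_filter_add_sum_filter_not Finset.univ
      (fun k : Fin (n + 1) => (k : ℕ) ≤ m) σ
    rw [h2, hσ, sum_softmax, ← hσ] at h3
    set l := ∑ k ∈ Finset.univ.filter (fun k : Fin (n + 1) => (k : ℕ) ≤ m), σ k
    have hl : 0 ≤ l := Finset.sum_nonneg fun k _ => (hpos k).le
    have h4 : σ k - 1 / ((n : ℝ) - m) = -(l / (n - m)) := by
      rw [show (1 : ℝ) = l + (n - m) * σ k from h3.symm]
      field_simp
      ring
    rw [h4, abs_neg, abs_of_nonneg (div_nonneg hl (by linarith))]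
    exact (div_le_self hl hmn1).trans h1
  · rw [highLimit, if_neg hk, sub_zero, abs_of_pos (hpos k)]
    refine le_trans ?_ h1
    exact Finset.single_le_sum (f := σ) (fun i _ => (hpos i).le) (by simpa using hk)

/-! ### Win frequency and average price in terms of the empirical distribution -/

section Empirical

variable {n m T : ℕ}

lemma sum_empirical_mul (ω : History n m T) (t : ℕ) (g : Fin (n + 1) × Fin (m + 1) → ℝ) :
    ∑ b, empirical ω t b * g b
      = (∑ s ∈ Finset.univ.filter (fun s : Fin T => (s : ℕ) < t), g (ω s).1) / t := by
  have h : ∀ b, empirical ω t b * g b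
      = (∑ s ∈ Finset.univ.filter (fun s : Fin T => (s : ℕ) < t),
        if (ω s).1 = b then g b else 0) / t := by
    intro b
    rw [empirical, ← Finset.sum_filter, Finset.filter_filter, Finset.sum_const, nsmul_eq_mul]
    ring
  simp only [h]
  rw [← Finset.sum_div, Finset.sum_comm]
  simp

lemma sum_empirical_ite (ω : History n m T) (t : ℕ) (b : Fin (n + 1) × Fin (m + 1)) :
    empirical ω t b = (∑ s ∈ Finset.univ.filter (fun s : Fin T => (s : ℕ) < t),
      if (ω s).1 = b then (1 : ℝ) else 0) / t := by
  rw [empirical, ← Finset.sum_filter, Finset.filter_filter, Finset.sum_const, nsmul_eq_mul, mul_one]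

lemma card_filter_val_lt {t : ℕ} (ht : t ≤ T) :
    (Finset.univ.filter fun s : Fin T => (s : ℕ) < t).card = t := by
  rw [Fin.card_filter_val_lt, min_eq_right ht]

/-- The rounds, among the first `t`, that the high player does not win. -/
noncomputable def lostRounds (ω : History n m T) (t : ℕ) : Finset (Fin T) :=
  (Finset.univ.filter fun s : Fin T => (s : ℕ) < t) \ wonRounds ω t

lemma wonRounds_subset (ω : History n m T) (t : ℕ) :
    wonRounds ω t ⊆ Finset.univ.filter fun s : Fin T => (s : ℕ) < t := by
  classical
  intro s hs
  rw [wonRounds, Finset.mem_filter] at hs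
  exact Finset.mem_filter.2 ⟨hs.1, hs.2.1⟩

lemma le_of_mem_lostRounds {ω : History n m T} {t : ℕ} {s : Fin T} (hs : s ∈ lostRounds ω t) :
    ((ω s).1.1 : ℕ) ≤ (ω s).1.2 := by
  classical
  rw [lostRounds, Finset.mem_sdiff, Finset.mem_filter, wonRounds, Finset.mem_filter] at hs
  by_contra! h
  exact hs.2 ⟨hs.1.1, hs.1.2, Or.inl h⟩

/-- If the high player always bids more than the low player under `p`, then he loses few auctions
when the empirical distribution is close to `p`. -/
lemma card_lostRounds_div_le (ω : History n m T) (t : ℕ) {p : Fin (n + 1) × Fin (m + 1) → ℝ}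
    (hp : ∀ b : Fin (n + 1) × Fin (m + 1), (b.1 : ℕ) ≤ b.2 → p b = 0) :
    ((lostRounds ω t).card : ℝ) / t
      ≤ Fintype.card (Fin (n + 1) × Fin (m + 1)) * dist (empirical ω t) p := by
  classical
  have h1 : ((lostRounds ω t).card : ℝ) / t
      ≤ ∑ b, empirical ω t b * if (b.1 : ℕ) ≤ b.2 then 1 else 0 := by
    rw [sum_empirical_mul ω t fun b => if (b.1 : ℕ) ≤ b.2 then 1 else 0]
    refine div_le_div_of_nonneg_right ?_ t.cast_nonneg
    rw [← Finset.sum_filter, Finset.sum_const, nsmul_eq_mul, mul_one]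
    exact_mod_cast Finset.card_le_card fun s hs => Finset.mem_filter.2
      ⟨(Finset.mem_sdiff.1 hs).1, le_of_mem_lostRounds hs⟩
  refine h1.trans ?_
  rw [← nsmul_eq_mul, ← Finset.card_univ, ← Finset.sum_const]
  refine Finset.sum_le_sum fun b _ => ?_
  split_ifs with hb
  · have := dist_le_pi_dist (empirical ω t) p b
    rw [hp b hb, Real.dist_0_eq_abs] at this
    rw [mul_one]
    exact (le_abs_self _).trans this
  · rw [mul_zero]
    exact dist_nonneg

lemma winFrequency_eq (ω : History n m T) {t : ℕ} (h0 : 0 < t) (ht : t ≤ T) :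
    winFrequency ω t = 1 - ((lostRounds ω t).card : ℝ) / t := by
  have h1 := Finset.card_sdiff_add_card_eq_card (wonRounds_subset ω t)
  rw [card_filter_val_lt ht] at h1
  have h2 : ((lostRounds ω t).card : ℝ) + (wonRounds ω t).card = t := by exact_mod_cast h1
  have h3 : (t : ℝ) ≠ 0 := by exact_mod_cast h0.ne'
  rw [winFrequency, eq_sub_iff_add_eq, ← add_div, add_comm, h2, div_self h3]

lemma dist_winFrequency_le (ω : History n m T) {t : ℕ} (h0 : 0 < t) (ht : t ≤ T)
    {p : Fin (n + 1) × Fin (m + 1) → ℝ}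
    (hp : ∀ b : Fin (n + 1) × Fin (m + 1), (b.1 : ℕ) ≤ b.2 → p b = 0) :
    dist (winFrequency ω t) 1
      ≤ Fintype.card (Fin (n + 1) × Fin (m + 1)) * dist (empirical ω t) p := by
  rw [winFrequency_eq ω h0 ht, Real.dist_eq, sub_sub_cancel_left, abs_neg,
    abs_of_nonneg (by positivity)]
  exact card_lostRounds_div_le ω t hp

/-- The average price is a quotient `W / f`, with `f` the win frequency. Three errors of size `V *
(K * e)` enter `W - μ * f`: the empirical mean against `μ`, the bids in lost rounds, and `f` against
`1`. Dividing by `f ≥ 1 / 2` doubles them, whence the `6`. -/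
lemma dist_averagePrice_le {ε : ℝ} (hε : 0 < ε) (ω : History n m T) {t : ℕ} (h0 : 0 < t)
    (ht : t ≤ T) {p : Fin (n + 1) × Fin (m + 1) → ℝ}
    (hpS : p ∈ stdSimplex ℝ (Fin (n + 1) × Fin (m + 1)))
    (hp : ∀ b : Fin (n + 1) × Fin (m + 1), (b.1 : ℕ) ≤ b.2 → p b = 0)
    (hd : Fintype.card (Fin (n + 1) × Fin (m + 1)) * dist (empirical ω t) p ≤ 1 / 2) :
    dist (averagePrice ε ω t) (∑ b, p b * bid ε b.2)
      ≤ 6 * (m * ε) * (Fintype.card (Fin (n + 1) × Fin (m + 1)) * dist (empirical ω t) p) := by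
  set K : ℝ := (Fintype.card (Fin (n + 1) × Fin (m + 1)) : ℝ) with hK
  set e := dist (empirical ω t) p
  set μ := ∑ b, p b * bid ε b.2
  set V : ℝ := m * ε
  have hV : 0 ≤ V := by positivity
  have ht' : (0 : ℝ) < t := by exact_mod_cast h0
  set W := (∑ s ∈ wonRounds ω t, bid ε (ω s).1.2) / t with hW
  set f := winFrequency ω t with hf
  have hf1 : f = 1 - ((lostRounds ω t).card : ℝ) / t := winFrequency_eq ω h0 ht
  have hl := card_lostRounds_div_le ω t hp
  have hl0 : 0 ≤ ((lostRounds ω t).card : ℝ) / t := by positivity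
  have hμ0 : 0 ≤ μ := Finset.sum_nonneg fun b _ => mul_nonneg (hpS.1 b) (bid_nonneg hε b.2)
  have hμV : μ ≤ V := by
    calc μ ≤ ∑ b, p b * V :=
          Finset.sum_le_sum fun b _ => mul_le_mul_of_nonneg_left (bid_le hε b.2) (hpS.1 b)
      _ = V := by rw [← Finset.sum_mul, hpS.2, one_mul]
  have hF : |∑ b, empirical ω t b * bid ε b.2 - μ| ≤ K * e * V := by
    rw [← Finset.sum_sub_distrib]
    refine (Finset.abs_sum_le_sum_abs _ _).trans ?_
    calc _ ≤ ∑ _b : Fin (n + 1) × Fin (m + 1), e * V := by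
          refine Finset.sum_le_sum fun b _ => ?_
          rw [← sub_mul, abs_mul, abs_of_nonneg (bid_nonneg hε b.2)]
          exact mul_le_mul (dist_le_pi_dist (empirical ω t) p b) (bid_le hε b.2)
            (bid_nonneg hε b.2) dist_nonneg
      _ = K * e * V := by
          rw [Finset.sum_const, Finset.card_univ, nsmul_eq_mul]
          ring
  have hFW : ∑ b, empirical ω t b * bid ε b.2
      = W + (∑ s ∈ lostRounds ω t, bid ε (ω s).1.2) / t := by
    rw [sum_empirical_mul ω t fun b => bid ε b.2, hW, ← add_div,
      ← Finset.sum_sdiff (wonRounds_subset ω t), add_comm]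
    rfl
  have hL0 : 0 ≤ (∑ s ∈ lostRounds ω t, bid ε (ω s).1.2) / t :=
    div_nonneg (Finset.sum_nonneg fun s _ => bid_nonneg hε _) ht'.le
  have hL1 : (∑ s ∈ lostRounds ω t, bid ε (ω s).1.2) / t ≤ V * (K * e) := by
    calc _ ≤ (∑ s ∈ lostRounds ω t, V) / t := by
          gcongr
          exact bid_le hε _
      _ = V * (((lostRounds ω t).card : ℝ) / t) := by
          rw [Finset.sum_const, nsmul_eq_mul]
          ring
      _ ≤ V * (K * e) := by gcongr
  have hf2 : 1 / 2 ≤ f := by linarith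
  have havg : averagePrice ε ω t = W / f := by
    rw [averagePrice, hW, hf, winFrequency]
    field_simp
  have hμl : 0 ≤ μ * (((lostRounds ω t).card : ℝ) / t) := by positivity
  have hμl' : μ * (((lostRounds ω t).card : ℝ) / t) ≤ V * (K * e) := by gcongr
  rw [havg, Real.dist_eq, show W / f - μ = (W - μ * f) / f by field_simp, abs_div,
    abs_of_pos (show 0 < f by linarith), div_le_iff₀ (by linarith)]
  have hKe : 0 ≤ V * (K * e) := hL0.trans hL1
  have h3 : |W - μ * f| ≤ 3 * (V * (K * e)) := by
    have := abs_le.1 hF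
    rw [hFW] at this
    rw [hf1, abs_le]
    constructor <;> nlinarith
  nlinarith

end Empirical

/-- A statistic that is controlled by the empirical distribution converges if the latter does. -/
lemma Converges.of_empirical {n m : ℕ} {E : Type} [PseudoMetricSpace E]
    {P : ∀ T : ℕ, History n m T → ℝ} {p : Fin (n + 1) × Fin (m + 1) → ℝ}
    {X : ∀ T : ℕ, History n m T → ℕ → E} {x : E}
    (hP : ∀ T ω, 0 ≤ P T ω) (h : Converges P (fun _ ω t => empirical ω t) p)
    (hX : ∀ δ : ℝ, 0 < δ → ∃ δ' : ℝ, 0 < δ' ∧ ∀ (T : ℕ) (ω : History n m T) (t : ℕ), 0 < t →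
      t ≤ T → dist (empirical ω t) p < δ' → dist (X T ω t) x < δ) :
    Converges P X x := by
  intro δ hδ
  obtain ⟨δ', hδ', hX⟩ := hX δ hδ
  obtain ⟨T₀, hT⟩ := h (min δ δ') (lt_min hδ hδ')
  refine ⟨T₀, fun T hT₀ => ?_⟩
  refine le_trans (by linarith [min_le_left δ δ']) ((hT T hT₀).trans (prob_mono (hP T) ?_))
  intro ω hω t ht htT
  have h0 : 0 < t := by
    have : (0 : ℝ) < t := lt_of_le_of_lt (by positivity) ht
    exact_mod_cast this
  refine hX T ω t h0 htT ((hω t (lt_of_le_of_lt ?_ ht) htT).trans_le (min_le_right _ _))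
  gcongr
  exact min_le_left _ _

/-- Convergence only depends on the laws at large horizons. -/
lemma Converges.congr {n m : ℕ} {E : Type} [PseudoMetricSpace E]
    {P Q : ∀ T : ℕ, History n m T → ℝ} {X : ∀ T : ℕ, History n m T → ℕ → E} {x : E}
    (h : Converges P X x) (hPQ : ∀ T, 1 ≤ T → P T = Q T) : Converges Q X x := by
  intro δ hδ
  obtain ⟨T₀, hT⟩ := h δ hδ
  exact ⟨T₀, fun T hT₀ => hPQ T (by omega) ▸ hT T hT₀⟩

/-! ### Convergence of the empirical distribution -/

namespace IsLimitRegime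

variable {n m : ℕ} {A : ℕ → Dynamics n m} {ε ρ : ℝ}

/-- The limit of the empirical distribution of the pair of bids. -/
noncomputable def limitLaw (h : IsLimitRegime A ε ρ) (b : Fin (n + 1) × Fin (m + 1)) : ℝ :=
  highLimit n m b.1 * softmax h.lowLimit b.2

lemma lowMarginal_limitLaw (h : IsLimitRegime A ε ρ) :
    lowMarginal h.limitLaw = softmax h.lowLimit := by
  ext j
  simp only [lowMarginal, limitLaw]
  rw [← Finset.sum_mul, sum_highLimit h.lt, one_mul]

lemma highMarginal_limitLaw (h : IsLimitRegime A ε ρ) :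
    highMarginal h.limitLaw = highLimit n m := by
  ext k
  simp only [highMarginal, limitLaw]
  rw [← Finset.mul_sum, sum_softmax, mul_one]

lemma limitLaw_mem_stdSimplex (h : IsLimitRegime A ε ρ) :
    h.limitLaw ∈ stdSimplex ℝ (Fin (n + 1) × Fin (m + 1)) := by
  refine ⟨fun b => mul_nonneg (highLimit_nonneg h.lt _) (softmax_pos _ _).le, ?_⟩
  have h1 : ∑ j, lowMarginal h.limitLaw j = 1 := by
    rw [h.lowMarginal_limitLaw]
    exact sum_softmax _
  rw [Fintype.sum_prod_type, Finset.sum_comm]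
  exact h1

lemma limitLaw_eq_zero (h : IsLimitRegime A ε ρ) {b : Fin (n + 1) × Fin (m + 1)}
    (hb : (b.1 : ℕ) ≤ b.2) : h.limitLaw b = 0 := by
  rw [limitLaw, highLimit, if_neg (by have := b.2.2; omega), zero_mul]

lemma abs_pairProb_sub_le (h : IsLimitRegime A ε ρ) (T : ℕ) (t : ℕ) (ω : History n m T)
    (b : Fin (n + 1) × Fin (m + 1)) :
    |(A T).pairProb t ω b - h.limitLaw b|
      ≤ (A T).losingMass t ω + 2 * ∑ j, |(A T).lowWeight t ω j - h.lowLimit j| := by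
  have h1 := (A T).abs_softmax_highWeight_sub_le h.lt t ω b.1
  have h2 := abs_softmax_sub_le ((A T).lowWeight t ω) h.lowLimit b.2 fun i =>
    Finset.single_le_sum (f := fun j => |(A T).lowWeight t ω j - h.lowLimit j|)
      (fun j _ => abs_nonneg _) (Finset.mem_univ i)
  rw [Dynamics.pairProb, limitLaw]
  set σ := softmax ((A T).highWeight t ω) b.1
  set τ := softmax ((A T).lowWeight t ω) b.2
  have e : σ * τ - highLimit n m b.1 * softmax h.lowLimit b.2
      = (σ - highLimit n m b.1) * τ + highLimit n m b.1 * (τ - softmax h.lowLimit b.2) := by ring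
  rw [e]
  refine (abs_add_le _ _).trans (add_le_add ?_ ?_)
  · rw [abs_mul, abs_of_pos (softmax_pos _ _ : 0 < τ)]
    exact (mul_le_of_le_one_right (abs_nonneg _) (softmax_le_one _ _)).trans h1
  · rw [abs_mul, abs_of_nonneg (highLimit_nonneg h.lt _)]
    exact (mul_le_of_le_one_left (abs_nonneg _) (highLimit_le_one h.lt _)).trans h2

/-- The conditional probabilities of the pairs of bids converge to the limit law on average. -/
lemma eventually_sum_mean_le (h : IsLimitRegime A ε ρ) {δ : ℝ} (hδ : 0 < δ) :
    ∀ᶠ T in atTop, ∀ b, mean ((A T).P T)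
      (fun ω => ∑ s : Fin T, |(A T).pairProb s ω b - h.limitLaw b|) ≤ δ * T := by
  -- The divisor `1 + 2 * (m + 1)` counts the error terms of `abs_pairProb_sub_le`: the losing mass,
  -- and twice each of the `m + 1` log-weights. Rounds before `roundAt N` are bounded trivially by
  -- `1`, and there are at most `δ / 2 * T` of them.
  obtain ⟨N, hN⟩ := h.exists_eventually_close (show 0 < δ / 2 / (1 + 2 * (m + 1)) by positivity)
  filter_upwards [hN, h.eventually_roundAt_le N.cast_nonneg (half_pos hδ)] with T h1 h2 b
  have hs : ∀ s : Fin T, mean ((A T).P T) (fun ω => |(A T).pairProb s ω b - h.limitLaw b|)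
      ≤ (if (s : ℕ) < (A T).roundAt N then 1 else 0) + δ / 2 := by
    intro s
    split_ifs with hsN
    · calc _ ≤ mean ((A T).P T) (fun _ => (1 : ℝ)) := by
            refine mean_mono (A T).P_nonneg fun ω => ?_
            have a1 := (A T).pairProb_mem s ω b
            have a2 := h.limitLaw_mem_stdSimplex.1 b
            have a3 : h.limitLaw b ≤ 1 :=
              mul_le_one₀ (highLimit_le_one h.lt _) (softmax_pos _ _).le (softmax_le_one _ _)
            rw [abs_le]
            constructor <;> linarith [a1.1, a1.2]
        _ ≤ _ := by
            rw [mean_const (A T).sum_P]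
            linarith
    · obtain ⟨b1, b2⟩ := h1 s (by omega) s.2.le
      calc _ ≤ mean ((A T).P T) (fun ω => (A T).losingMass s ω
              + 2 * ∑ j, |(A T).lowWeight s ω j - h.lowLimit j|) :=
            mean_mono (A T).P_nonneg fun ω => h.abs_pairProb_sub_le T s ω b
        _ = mean ((A T).P T) ((A T).losingMass s)
              + 2 * ∑ j, mean ((A T).P T) (fun ω => |(A T).lowWeight s ω j - h.lowLimit j|) := by
            rw [mean_add, mean_const_mul, mean_sum]
        _ ≤ δ / 2 / (1 + 2 * (m + 1)) + 2 * ∑ _j : Fin (m + 1), δ / 2 / (1 + 2 * (m + 1)) := by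
            gcongr with j
            exact b1 j
        _ = 0 + δ / 2 := by
            rw [Finset.sum_const, Finset.card_univ, Fintype.card_fin, nsmul_eq_mul]
            push_cast
            field_simp
            ring
  rw [mean_sum]
  refine (Finset.sum_le_sum fun s _ => hs s).trans ?_
  rw [Finset.sum_add_distrib, ← Finset.sum_filter, Finset.sum_const, Finset.sum_const,
    Fin.card_filter_val_lt, Finset.card_univ, Fintype.card_fin, nsmul_eq_mul, nsmul_eq_mul]
  have : ((min T ((A T).roundAt N) : ℕ) : ℝ) ≤ (A T).roundAt N := by
    exact_mod_cast min_le_right _ _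
  linarith

lemma converges_empirical (h : IsLimitRegime A ε ρ) :
    Converges (fun T => (A T).P T) (fun _ ω t => empirical ω t) h.limitLaw := by
  intro δ hδ
  set K : ℝ := (Fintype.card (Fin (n + 1) × Fin (m + 1)) : ℝ) with hK
  have hK0 : 0 < K := by
    rw [hK]
    exact_mod_cast Fintype.card_pos
  -- Two errors of size `c * T` add up to `δ * (δ * T) < δ * t`, since only times `t > δ * T`
  -- matter. Each of the `2 * K` bad events is allowed probability `δ / (2 * K)`.
  set c := δ ^ 2 / 2 with hc
  have hc0 : 0 < c := by positivity
  have h1 := h.eventually_sum_mean_le (show 0 < c * (δ / (2 * K)) by positivity)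
  have h2 : ∀ᶠ T : ℕ in atTop, 1 / (c ^ 2 * (δ / (2 * K))) ≤ (T : ℝ) :=
    tendsto_natCast_atTop_atTop.eventually_ge_atTop _
  obtain ⟨T₀, hT₀⟩ := eventually_atTop.1 (h1.and (h2.and (eventually_ge_atTop 1)))
  refine ⟨T₀, fun T hT => ?_⟩
  obtain ⟨h1, h2, h3⟩ := hT₀ T hT.le
  have hTpos : (0 : ℝ) < T := by exact_mod_cast h3
  have hnn := (A T).P_nonneg (T := T)
  let bad₁ : Fin (n + 1) × Fin (m + 1) → Set (History n m T) := fun b =>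
    {ω | ∃ s ≤ T, c * T ≤ |(A T).deviation b s ω|}
  let bad₂ : Fin (n + 1) × Fin (m + 1) → Set (History n m T) := fun b =>
    {ω | c * T ≤ ∑ s : Fin T, |(A T).pairProb s ω b - h.limitLaw b|}
  have hb₁ : ∀ b, prob ((A T).P T) (bad₁ b) ≤ δ / (2 * K) := by
    intro b
    have a1 := (A T).prob_deviation_le (T := T) b (show 0 < c * T by positivity)
    rw [div_le_iff₀ (by positivity)] at h2
    have a2 : (c * T) ^ 2 * prob ((A T).P T) (bad₁ b) ≤ (c * T) ^ 2 * (δ / (2 * K)) := by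
      refine a1.trans ?_
      calc (T : ℝ) = T * 1 := (mul_one _).symm
        _ ≤ T * (T * (c ^ 2 * (δ / (2 * K)))) := by gcongr
        _ = _ := by ring
    exact le_of_mul_le_mul_left a2 (by positivity)
  have hb₂ : ∀ b, prob ((A T).P T) (bad₂ b) ≤ δ / (2 * K) := by
    intro b
    have a1 := mul_prob_le_mean hnn (f := fun ω => ∑ s : Fin T,
      |(A T).pairProb s ω b - h.limitLaw b|) (fun ω => Finset.sum_nonneg fun s _ => abs_nonneg _)
      (c * T)
    have a2 : (c * T) * prob ((A T).P T) (bad₂ b) ≤ (c * T) * (δ / (2 * K)) := by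
      refine (a1.trans (h1 b)).trans (le_of_eq ?_)
      ring
    exact le_of_mul_le_mul_left a2 (by positivity)
  have hbad : prob ((A T).P T) (⋃ b, bad₁ b ∪ bad₂ b) ≤ δ := by
    calc _ ≤ ∑ b, prob ((A T).P T) (bad₁ b ∪ bad₂ b) := prob_iUnion_le hnn _
      _ ≤ ∑ _b : Fin (n + 1) × Fin (m + 1), (δ / (2 * K) + δ / (2 * K)) :=
          Finset.sum_le_sum fun b _ =>
            (prob_union_le hnn _ _).trans (add_le_add (hb₁ b) (hb₂ b))
      _ = δ := by
          rw [Finset.sum_const, Finset.card_univ, nsmul_eq_mul, ← hK]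
          field_simp
          ring
  have hgood := prob_compl (A T).sum_P (⋃ b, bad₁ b ∪ bad₂ b)
  refine le_trans (by linarith : 1 - δ ≤ prob ((A T).P T) (⋃ b, bad₁ b ∪ bad₂ b)ᶜ)
    (prob_mono hnn ?_)
  intro ω hω t ht htT
  have ht0 : (0 : ℝ) < t := lt_of_le_of_lt (by positivity) ht
  refine (dist_pi_lt_iff hδ).2 fun b => ?_
  simp only [Set.mem_compl_iff, Set.mem_iUnion, not_exists] at hω
  have hω := hω b
  have g1 : |(A T).deviation b t ω| < c * T := by
    by_contra! hcon
    exact hω (Or.inl ⟨t, htT, hcon⟩)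
  have g2 : ∑ s : Fin T, |(A T).pairProb s ω b - h.limitLaw b| < c * T := by
    by_contra! hcon
    exact hω (Or.inr hcon)
  -- Martingale part plus accumulated error of the conditional probabilities. Both are bounded
  -- simultaneously for all `t ≤ T`, so no union over times is needed.
  have g3 : (empirical ω t b - h.limitLaw b) * t = (A T).deviation b t ω
      + ∑ s ∈ Finset.univ.filter (fun s : Fin T => (s : ℕ) < t),
        ((A T).pairProb s ω b - h.limitLaw b) := by
    rw [Dynamics.deviation, ← Finset.sum_add_distrib, sum_empirical_ite, sub_mul,
      div_mul_cancel₀ _ ht0.ne']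
    simp only [sub_add_sub_cancel]
    rw [Finset.sum_sub_distrib, Finset.sum_const, card_filter_val_lt htT, nsmul_eq_mul,
      mul_comm (t : ℝ)]
  have g4 : |∑ s ∈ Finset.univ.filter (fun s : Fin T => (s : ℕ) < t),
      ((A T).pairProb s ω b - h.limitLaw b)|
      ≤ ∑ s : Fin T, |(A T).pairProb s ω b - h.limitLaw b| :=
    (Finset.abs_sum_le_sum_abs _ _).trans
      (Finset.sum_le_sum_of_subset_of_nonneg (Finset.subset_univ _) fun _ _ _ => abs_nonneg _)
  have g5 : |empirical ω t b - h.limitLaw b| * t < δ * t := by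
    rw [← abs_of_pos ht0, ← abs_mul, abs_of_pos ht0, g3]
    refine (abs_add_le _ _).trans_lt ?_
    have : 2 * (c * T) = δ * (δ * T) := by
      rw [hc]
      ring
    have : δ * (δ * T) < δ * t := by gcongr
    linarith
  rw [Real.dist_eq]
  exact lt_of_mul_lt_mul_right g5 ht0.le

end IsLimitRegime

end MWAuction

/-! ### The limit theorem -/

theorem theorem1
    -- the grid, and the values of the two players
    (ε v w : ℝ) (hε : 0 < ε) (n m : ℕ) (hv : v = n * ε) (hw : w = m * ε) (hwv : w < v)
    -- the variant of multiplicative weights of each agent, and its update parameter at horizon `T`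
    (rule₁ rule₂ : UpdateRule) (η₁ η₂ : ℕ → ℝ)
    (hη₁ : ∀ T, 1 ≤ T → 0 < η₁ T) (hη₂ : ∀ T, 1 ≤ T → 0 < η₂ T)
    (hη₁_zero : Tendsto η₁ atTop (𝓝 0))
    (hη₁_large : Tendsto (fun T : ℕ => (T : ℝ) * η₁ T) atTop atTop)
    (ρ : ℝ) (hρ : 0 < ρ) (hη_ratio : Tendsto (fun T : ℕ => η₂ T / η₁ T) atTop (𝓝 ρ)) :
    ∃ p : Fin (n + 1) × Fin (m + 1) → ℝ,
      p ∈ stdSimplex ℝ (Fin (n + 1) × Fin (m + 1)) ∧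
      -- the dynamics converge to `p`
      Converges (fun T (ω : History n m T) => law rule₁ rule₂ (η₁ T) (η₂ T) ε ω)
        (fun _ ω t => empirical ω t) p ∧
      -- the high player's bids are uniform on `(w, v]`
      (∀ k : Fin (n + 1), bid ε k ≤ w → highMarginal p k = 0) ∧
      (∀ k : Fin (n + 1), w < bid ε k → highMarginal p k = ε / (v - w)) ∧
      -- the low player's bids have full support on `[0, w]`, with non-decreasing probabilities
      (∀ j : Fin (m + 1), 0 < lowMarginal p j) ∧
      Monotone (lowMarginal p) ∧
      -- in the limit the high player always wins, under `p` and along the dynamics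
      (∀ b : Fin (n + 1) × Fin (m + 1), p b ≠ 0 → bid ε b.2 < bid ε b.1) ∧
      Converges (fun T (ω : History n m T) => law rule₁ rule₂ (η₁ T) (η₂ T) ε ω)
        (fun _ ω t => winFrequency ω t) 1 ∧
      -- the average price that he pays converges to its mean under `p`, strictly less than `w`
      Converges (fun T (ω : History n m T) => law rule₁ rule₂ (η₁ T) (η₂ T) ε ω)
        (fun _ ω t => averagePrice ε ω t) (∑ b, p b * bid ε b.2) ∧
      (0 < w → ∑ b, p b * bid ε b.2 < w) := by
  have hmn : m < n := by
    rw [hv, hw, mul_lt_mul_iff_left₀ hε] at hwv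
    exact_mod_cast hwv
  -- The parameters are positive only for `T ≥ 1`; `max T 1` supplies a harmless value at `T = 0`.
  let A : ℕ → Dynamics n m := fun T =>
    { rule₁ := rule₁, rule₂ := rule₂, η₁ := η₁ (max T 1), η₂ := η₂ (max T 1), ε := ε,
      η₁_pos := hη₁ _ (le_max_right _ _), η₂_pos := hη₂ _ (le_max_right _ _), ε_pos := hε }
  have hA : ∀ᶠ T : ℕ in atTop, max T 1 = T :=
    (eventually_ge_atTop 1).mono fun T hT => max_eq_left hT
  have h : IsLimitRegime A ε ρ :=
    { lt := hmn
      ratio_pos := hρ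
      bid_unit := fun _ => rfl
      tendsto_zero := hη₁_zero.congr' (hA.mono fun T hT => by simp only [A, hT])
      tendsto_atTop := hη₁_large.congr' (hA.mono fun T hT => by simp only [A, hT])
      tendsto_ratio := hη_ratio.congr' (hA.mono fun T hT => by simp only [A, hT]) }
  have hlaw : ∀ T, 1 ≤ T → (A T).P T = fun ω => law rule₁ rule₂ (η₁ T) (η₂ T) ε ω := by
    intro T hT
    rw [← (A T).law_eq]
    simp only [A, max_eq_left hT]
  have hP : ∀ T ω, 0 ≤ (A T).P T ω := fun T => (A T).P_nonneg
  have hS := h.limitLaw_mem_stdSimplex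
  have hzero : ∀ b : Fin (n + 1) × Fin (m + 1), (b.1 : ℕ) ≤ b.2 → h.limitLaw b = 0 :=
    fun b hb => h.limitLaw_eq_zero hb
  have hbid : ∀ k : Fin (n + 1), w < bid ε k ↔ m < (k : ℕ) := fun k => by
    rw [hw, bid, mul_lt_mul_iff_left₀ hε]
    exact Nat.cast_lt
  set K : ℝ := (Fintype.card (Fin (n + 1) × Fin (m + 1)) : ℝ) with hK
  have hK0 : 0 < K := by
    rw [hK]
    exact_mod_cast Fintype.card_pos
  refine ⟨h.limitLaw, hS, h.converges_empirical.congr hlaw, fun k hk => ?_, fun k hk => ?_,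
    fun j => ?_, ?_, fun b hb => ?_, ?_, ?_, fun hw0 => ?_⟩
  · rw [h.highMarginal_limitLaw, highLimit, if_neg]
    rw [← hbid]
    exact not_lt.2 hk
  · rw [h.highMarginal_limitLaw, highLimit, if_pos ((hbid k).1 hk), hv, hw, ← sub_mul]
    field_simp
  · rw [h.lowMarginal_limitLaw]
    exact softmax_pos _ _
  · rw [h.lowMarginal_limitLaw]
    exact fun i j hij => softmax_le_softmax _ (h.lowLimit_mono hij)
  · rw [bid_lt_bid_iff hε]
    by_contra! hcon
    exact hb (hzero b hcon)
  · refine (h.converges_empirical.of_empirical hP fun δ hδ => ⟨δ / K, by positivity, ?_⟩).congr hlaw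
    intro T ω t h0 ht hd
    rw [lt_div_iff₀ hK0, mul_comm] at hd
    exact (dist_winFrequency_le ω h0 ht hzero).trans_lt hd
  -- The `1 / 2` keeps the win frequency away from zero; the `+ 1` keeps the denominator positive
  -- when `m = 0`.
  · refine (h.converges_empirical.of_empirical hP fun δ hδ =>
      ⟨min (1 / 2) (δ / (6 * (m * ε) + 1)) / K, by positivity, ?_⟩).congr hlaw
    intro T ω t h0 ht hd
    rw [lt_div_iff₀ hK0, mul_comm, lt_min_iff] at hd
    have hd2 := (lt_div_iff₀ (by positivity)).1 hd.2
    refine (dist_averagePrice_le hε ω h0 ht hS hzero hd.1.le).trans_lt ?_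
    have : 0 ≤ K * dist (empirical ω t) h.limitLaw := by positivity
    rw [← hK]
    rcases this.eq_or_lt with h2 | h2
    · rw [← h2]
      simpa using hδ
    · linarith
  · have h1 : ∑ b, h.limitLaw b * bid ε b.2 = ∑ j, softmax h.lowLimit j * bid ε j := by
      rw [Fintype.sum_prod_type, Finset.sum_comm, ← h.lowMarginal_limitLaw]
      exact Finset.sum_congr rfl fun j _ => by rw [lowMarginal, Finset.sum_mul]
    have h2 : w = ∑ j, softmax h.lowLimit j * w := by
      rw [← Finset.sum_mul, sum_softmax, one_mul]
    rw [h1, h2]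
    -- The bid `0` makes the inequality strict: it lies below `w` and keeps positive probability in
    -- the limit.
    refine Finset.sum_lt_sum (fun j _ => ?_) ⟨0, Finset.mem_univ _, ?_⟩
    · exact mul_le_mul_of_nonneg_left (hw ▸ bid_le hε j) (softmax_pos _ _).le
    · exact mul_lt_mul_of_pos_left (by simpa [bid] using hw0) (softmax_pos _ _)
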